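/- Walsh functions $w_l$ ($l\ge 0$) on $\mathbb R$ are defined by $w_0=\chi_{[0,1)}$, $w_{2l}(x)=w_l(2x)+w_l(2x-1)$, $w_{2l+1}(x)=w_l(2x)-w_l(2x-1)$. A tile is a rectangle $P=I_P\times\omega_P=[2^{-k}n,2^{-k}(n+1))\times[2^kl,2^k(l+1))$ with $k,n\in\mathbb Z$, $l\in\mathbb Z_{\ge0}$; its wave packet is $\phi_P(x)=2^{k/2}w_l(2^kx-n)$. A quartile is a rectangle $P=I_P\times\omega_P=[2^{-k}n,2^{-k}(n+1))\times[2^{k+2}l,2^{k+2}(l+1))$ with $k,n\in\mathbb Z$, $l\in\mathbb Z_{\ge0}$; for $j=1,2,3$ its sub-tile is $P_j=[2^{-k}n,2^{-k}(n+1))\times[2^k(4l+j-1),2^k(4l+j))$. Write $\langle f,g\rangle=\int_{\mathbb R}f\bar g$ and $|\cdot|$ for Lebesgue measure. For a set $E\subset\mathbb R$ of finite measure let $X(E)$ be the space of (complex-valued, measurable) functions $f$ supported on $E$ with $\|f\|_\infty\le1$. Let $\mathbf P,\mathbf Q$ be finite collections of quartiles. For a sequence of complex numbers $(a_{Q_3})_{Q\in\mathbf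 Q}$ put $$\mathrm{energy}_3\big((a_{Q_3})_{Q\in\mathbf Q}\big):=\sup_{\mathbf D}\Big(\sum_{Q\in\mathbf D}|a_{Q_3}|^2\Big)^{1/2},$$ where $\mathbf D$ ranges over all subsets of $\mathbf Q$ such that the tiles $Q_3$, $Q\in\mathbf D$, are pairwise disjoint. Given $f_3,f_4$, put for $Q\in\mathbf Q$ $$a^{(3)}_{Q_3}:=\sum_{P\in\mathbf P;\ \omega_{Q_3}\subseteq\omega_{P_1}}\frac1{|I_P|^{1/2}}\langle f_3,\phi_{P_2}\rangle\langle f_4,\phi_{P_3}\rangle\langle\phi_{P_1},\phi_{Q_3}\rangle .$$ **Lemma 6.3.** For every $0<\theta<1$ there is a constant $C>0$ depending only on $\theta$ such that for all finite collections of quartiles $\mathbf P,\mathbf Q$, all sets $E_3,E_4\subset\mathbb R$ of finite measure and all $f_3\in X(E_3)$, $f_4\in X(E_4)$, $$\mathrm{energy}_3\big((a^{(3)}_{Q_3})_{Q\in\mathbf Q}\big)\le C\Big(|E_4|^{1/2}\sup_{P\in\mathbf P}\frac{|E_3\cap I_P|}{|I_P|}\Big)^{1-\theta}\Big(|E_3|^{1/2}\sup_{P\in\mathbf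 P}\frac{|E_4\cap I_P|}{|I_P|}\Big)^{\theta},$$ where the suprema are $0$ if $\mathbf P$ is empty. -/

import Mathlib

open MeasureTheory

noncomputable section

namespace WalshBiest

/-- The Walsh functions: `w_0` is the indicator function of `[0,1)`,
`w_{2l}(x) = w_l(2x) + w_l(2x-1)` and `w_{2l+1}(x) = w_l(2x) - w_l(2x-1)`.
The three equations are proved below as `walsh_zero`, `walsh_two_mul`, `walsh_two_mul_add_one`. -/
def walsh (l : ℕ) (x : ℝ) : ℝ :=
  if l = 0 then (Set.Ico (0 : ℝ) 1).indicator (fun _ => 1) x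
  else if l % 2 = 0 then walsh (l / 2) (2 * x) + walsh (l / 2) (2 * x - 1)
  else walsh (l / 2) (2 * x) - walsh (l / 2) (2 * x - 1)
termination_by l
decreasing_by all_goals omega

theorem walsh_zero (x : ℝ) : walsh 0 x = (Set.Ico (0 : ℝ) 1).indicator (fun _ => 1) x := by
  rw [walsh]; simp

theorem walsh_two_mul (l : ℕ) (x : ℝ) :
    walsh (2 * l) x = walsh l (2 * x) + walsh l (2 * x - 1) := by
  rcases Nat.eq_zero_or_pos l with rfl | hl
  · simp only [Nat.mul_zero, walsh_zero, Set.indicator_apply, Set.mem_Ico]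
    split_ifs <;> grind
  · rw [walsh]
    have h1 : 2 * l ≠ 0 := by omega
    have h2 : 2 * l % 2 = 0 := by omega
    have h3 : 2 * l / 2 = l := by omega
    rw [if_neg h1, if_pos h2, h3]

theorem walsh_two_mul_add_one (l : ℕ) (x : ℝ) :
    walsh (2 * l + 1) x = walsh l (2 * x) - walsh l (2 * x - 1) := by
  rw [walsh]
  have h1 : 2 * l + 1 ≠ 0 := by omega
  have h2 : ¬ (2 * l + 1) % 2 = 0 := by omega
  have h3 : (2 * l + 1) / 2 = l := by omega
  rw [if_neg h1, if_neg h2, h3]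

/-- The dyadic interval `[2^m a, 2^m (a+1))`. -/
def dyadic (m a : ℤ) : Set ℝ :=
  Set.Ico ((2 : ℝ) ^ m * a) ((2 : ℝ) ^ m * (a + 1))

/-- A tile: the dyadic rectangle `[2^{-k} n, 2^{-k} (n+1)) × [2^k l, 2^k (l+1))` of area one,
recorded by its parameters. The frequency index `l` is non-negative, as it indexes a
Walsh function. -/
@[ext]
structure Tile where
  k : ℤ
  n : ℤ
  l : ℕ

/-- The time interval `I_P` of a tile. -/
def Tile.I (P : Tile) : Set ℝ := dyadic (-P.k) P.n

/-- The frequency interval `ω_P` of a tile. -/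
def Tile.ω (P : Tile) : Set ℝ := dyadic P.k P.l

/-- The tile as a subset of the phase plane. -/
def Tile.rect (P : Tile) : Set (ℝ × ℝ) := P.I ×ˢ P.ω

/-- The Walsh wave packet `φ_P(x) = 2^{k/2} w_l(2^k x - n)`, regarded as complex valued. -/
def Tile.φ (P : Tile) (x : ℝ) : ℂ :=
  (((2 : ℝ) ^ ((P.k : ℝ) / 2) * walsh P.l ((2 : ℝ) ^ P.k * x - P.n) : ℝ) : ℂ)

/-- A quartile: the dyadic rectangle `[2^{-k} n, 2^{-k} (n+1)) × [2^{k+2} l, 2^{k+2} (l+1))`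
of area four, recorded by its parameters. -/
@[ext]
structure Quartile where
  k : ℤ
  n : ℤ
  l : ℕ

/-- The time interval `I_P` of a quartile. -/
def Quartile.I (P : Quartile) : Set ℝ := dyadic (-P.k) P.n

/-- The sub-tiles of a quartile. The index is zero based: `P.sub 0`, `P.sub 1`, `P.sub 2` are the
sub-tiles `P_1`, `P_2`, `P_3`, where
`P_j = [2^{-k} n, 2^{-k} (n+1)) × [2^k (4l+j-1), 2^k (4l+j))`. -/
def Quartile.sub (P : Quartile) (j : Fin 3) : Tile := ⟨P.k, P.n, 4 * P.l + j⟩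

/-- The pairing `⟨f, g⟩ = ∫ f(x) conj(g(x)) dx`. -/
def pairing (f g : ℝ → ℂ) : ℂ := ∫ x, f x * (starRingEnd ℂ) (g x)

/-- `X(E)`: the (almost everywhere classes of) measurable functions supported on `E`
with `‖f‖_∞ ≤ 1`. -/
def X (E : Set ℝ) : Set (ℝ → ℂ) :=
  {f | AEStronglyMeasurable f volume ∧ (∀ᵐ x, x ∉ E → f x = 0) ∧ eLpNorm f ⊤ volume ≤ 1}

/-- The energy of a sequence `(a_{P_j})_{P ∈ Ps}` (zero-based `j`): the supremum of
`(∑_{P ∈ D} |a_{P_j}|²)^{1/2}` over all `D ⊆ Ps` for which the tiles `P_j`, `P ∈ D`, are pairwise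
disjoint. The supremum is over a finite set of reals which is non-empty because of `D = ∅`. -/
def energy (j : Fin 3) (Ps : Finset Quartile) (a : Quartile → ℂ) : ℝ :=
  sSup {s : ℝ | ∃ D : Finset Quartile, D ⊆ Ps ∧
    (D : Set Quartile).Pairwise (fun P P' => Disjoint (P.sub j).rect (P'.sub j).rect) ∧
    s = (∑ P ∈ D, ‖a P‖ ^ 2) ^ (1 / 2 : ℝ)}

open Classical in
/-- The sequence `a^{(3)}_{Q_3}`: the sum over all `P ∈ Ps` with `ω_{Q_3} ⊆ ω_{P_1}` of
`|I_P|^{-1/2} ⟨f₃, φ_{P_2}⟩ ⟨f₄, φ_{P_3}⟩ ⟨φ_{P_1}, φ_{Q_3}⟩`. -/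
def a3 (Ps : Finset Quartile) (f₃ f₄ : ℝ → ℂ) (Q : Quartile) : ℂ :=
  ∑ P ∈ Ps with (Q.sub 2).ω ⊆ (P.sub 0).ω,
    ((1 / (volume.real P.I) ^ (1 / 2 : ℝ) : ℝ) : ℂ) *
      pairing f₃ (P.sub 1).φ * pairing f₄ (P.sub 2).φ * pairing (P.sub 0).φ (Q.sub 2).φ

/-- `sup_{P ∈ Ps} |E ∩ I_P| / |I_P|`, which is `0` when `Ps` is empty. -/
def supDensity (Ps : Finset Quartile) (E : Set ℝ) : ℝ :=
  ⨆ P : Ps, volume.real (E ∩ (P : Quartile).I) / volume.real (P : Quartile).I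

end WalshBiest

end

noncomputable section

namespace WalshBiest

open scoped InnerProductSpace ComplexConjugate

/-! The energy is removed by duality. For a family `D` with disjoint tiles `Q₃`, let `A` be the ℓ²
norm of the coefficients on `D` and pair them with their conjugates. Interchanging the sums turns
`A²` into a sum over `P` of `|I_P|^{-1/2} ⟨f₃, φ_{P₂}⟩ ⟨f₄, φ_{P₃}⟩` times a sum over those `Q ∈ D`
with `ω_{Q₃} ⊆ ω_{P₁}`. Since the tiles `Q₃` are disjoint, the frequency restriction deletes either
nothing or everything that does not already vanish by orthogonality (`norm_restricted_sum_le`).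
Hence, up to absolute value, the inner sum is at most a wave packet coefficient on `P₁` of one
function of norm `A`.

What is left is a trilinear form with energies `A`, `|E₃|^{1/2}`, `|E₄|^{1/2}`, all by Bessel's
inequality. The second and third sequences also have sizes (normalised ℓ² means over trees) bounded
by the densities of `E₃` and `E₄`; no size bound is available for the first. The form is estimated
by levels (`sum_triWeight_iterate`): when every size is at most `t` times the energy, trees are
removed greedily until `t` can be halved (`exists_selection`), and the tree estimate bounds what was
removed. With `x`, `y` the size-to-energy ratios of the last two sequences, the loss at level `t` is
`min(t,x) min(t,y)/t` times the product of the energies. It decays geometrically on both sides of `t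
= x^{1-θ} y^θ` because `0 < θ < 1`, so the levels can be summed; the result is linear in `A`, and
one factor `A` cancels.

The size bound (`sum_tree_coeff_le`) is an L² bound by the density, although averages of `|f|` are
controlled only on the intervals of the collection. It is proved by induction on scales with a
convex function that is quadratic for small arguments and linear for large ones. -/

/-! ### Dyadic intervals. -/

theorem left_mem_dyadic (m a : ℤ) : (2 : ℝ) ^ m * a ∈ dyadic m a := by
  have : (0 : ℝ) < 2 ^ m := by positivity
  refine ⟨le_rfl, ?_⟩
  nlinarith

theorem dyadic_subset_of_mem {m m' a a' : ℤ} {x : ℝ} (h : m ≤ m') (hx : x ∈ dyadic m a)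
    (hx' : x ∈ dyadic m' a') : dyadic m a ⊆ dyadic m' a' := by
  obtain ⟨d, rfl⟩ := Int.le.dest h
  have hp : (0 : ℝ) < 2 ^ m := by positivity
  have hd : (2 : ℝ) ^ (m + d) = 2 ^ m * ((2 ^ d : ℤ) : ℝ) := by
    rw [zpow_add₀ two_ne_zero]; simp
  simp only [dyadic, hd, mul_assoc] at hx hx' ⊢
  obtain ⟨h1, h2⟩ := hx
  obtain ⟨h3, h4⟩ := hx'
  have h5 : ((2 ^ d * a' : ℤ) : ℝ) < ((a + 1 : ℤ) : ℝ) := by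
    push_cast; push_cast at h3
    exact lt_of_mul_lt_mul_left (h3.trans_lt h2) hp.le
  have h6 : ((a : ℤ) : ℝ) < ((2 ^ d * (a' + 1) : ℤ) : ℝ) := by
    push_cast; push_cast at h4
    exact lt_of_mul_lt_mul_left (h1.trans_lt h4) hp.le
  have h7 : 2 ^ d * a' ≤ a := Int.lt_add_one_iff.1 (by exact_mod_cast h5)
  have h8 : a + 1 ≤ 2 ^ d * (a' + 1) := Int.add_one_le_iff.2 (by exact_mod_cast h6)
  apply Set.Ico_subset_Ico
  · exact mul_le_mul_of_nonneg_left (by exact_mod_cast h7) hp.le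
  · exact mul_le_mul_of_nonneg_left (by exact_mod_cast h8) hp.le

theorem eq_of_mem_dyadic {m a a' : ℤ} {x : ℝ} (hx : x ∈ dyadic m a) (hx' : x ∈ dyadic m a') :
    a = a' := by
  have hp : (0 : ℝ) < 2 ^ m := by positivity
  have h5 : (a' : ℝ) < a + 1 := lt_of_mul_lt_mul_left (hx'.1.trans_lt hx.2) hp.le
  have h6 : (a : ℝ) < a' + 1 := lt_of_mul_lt_mul_left (hx.1.trans_lt hx'.2) hp.le
  norm_cast at h5 h6
  omega

theorem measurableSet_dyadic (m a : ℤ) : MeasurableSet (dyadic m a) := measurableSet_Ico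

theorem volume_dyadic (m a : ℤ) : volume (dyadic m a) = ENNReal.ofReal (2 ^ m) := by
  rw [dyadic, Real.volume_Ico]; congr 1; ring

theorem volume_real_dyadic (m a : ℤ) : volume.real (dyadic m a) = 2 ^ m := by
  rw [measureReal_def, volume_dyadic, ENNReal.toReal_ofReal (by positivity)]

theorem le_of_dyadic_subset {m m' a a' : ℤ} (h : dyadic m a ⊆ dyadic m' a') : m ≤ m' := by
  have := measureReal_mono (μ := volume) h (by rw [volume_dyadic]; exact ENNReal.ofReal_ne_top)
  rw [volume_real_dyadic, volume_real_dyadic] at this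
  exact (zpow_le_zpow_iff_right₀ one_lt_two).1 this

theorem dyadic_subset_div (m a : ℤ) (d : ℕ) : dyadic m a ⊆ dyadic (m + d) (a / 2 ^ d) := by
  refine dyadic_subset_of_mem (by omega) (left_mem_dyadic m a) ?_
  have hp : (0 : ℝ) < 2 ^ m := by positivity
  have hd : (2 : ℝ) ^ (m + d) = 2 ^ m * ((2 ^ d : ℤ) : ℝ) := by
    rw [zpow_add₀ two_ne_zero]; simp
  have h2 : (0 : ℤ) < 2 ^ d := by positivity
  rw [dyadic, hd, mul_assoc, mul_assoc]
  constructor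
  · apply mul_le_mul_of_nonneg_left _ hp.le
    exact_mod_cast Int.mul_ediv_self_le h2.ne'
  · apply mul_lt_mul_of_pos_left _ hp
    have := Int.lt_mul_ediv_self_add (x := a) h2
    have h3 : a < 2 ^ d * (a / 2 ^ d + 1) := by rw [mul_add, mul_one]; exact this
    exact_mod_cast h3

/-! ### Geometry of quartiles and their sub-tiles. -/

theorem Quartile.volume_real_I (P : Quartile) : volume.real P.I = 2 ^ (-P.k) :=
  volume_real_dyadic _ _

theorem Quartile.volume_real_I_pos (P : Quartile) : 0 < volume.real P.I := by
  rw [P.volume_real_I]; positivity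

theorem not_disjoint_rect_iff {s t : Tile} :
    ¬ Disjoint s.rect t.rect ↔ (∃ x, x ∈ s.I ∧ x ∈ t.I) ∧ ∃ x, x ∈ s.ω ∧ x ∈ t.ω := by
  rw [Tile.rect, Tile.rect, Set.disjoint_prod, not_or, Set.not_disjoint_iff, Set.not_disjoint_iff]

/-- The frequency interval of a quartile sub-tile lies in that of the quartile. -/
theorem Quartile.sub_ω_subset (P : Quartile) (i : Fin 3) :
    (P.sub i).ω ⊆ dyadic (P.k + 2) P.l := by
  have h := dyadic_subset_div P.k ((4 * P.l + i : ℕ) : ℤ) 2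
  have h2 : (((4 * P.l + i : ℕ) : ℤ) / 2 ^ 2) = P.l := by
    have := i.2
    push_cast; omega
  rw [h2] at h
  exact h

theorem Quartile.lt_of_mem_sub {P : Quartile} {i j : Fin 3} (hij : i < j) {x y : ℝ}
    (hx : x ∈ (P.sub i).ω) (hy : y ∈ (P.sub j).ω) : x < y := by
  refine hx.2.trans_le (le_trans ?_ hy.1)
  apply mul_le_mul_of_nonneg_left _ (by positivity)
  have : (i : ℕ) < j := hij
  simp only [Quartile.sub]
  norm_cast
  omega

theorem Quartile.sub_index_eq {P : Quartile} {i j : Fin 3} {x : ℝ}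
    (hx : x ∈ (P.sub i).ω) (hy : x ∈ (P.sub j).ω) : i = j := by
  rcases lt_trichotomy i j with h | h | h
  · exact absurd (P.lt_of_mem_sub h hx hy) (lt_irrefl _)
  · exact h
  · exact absurd (P.lt_of_mem_sub h hy hx) (lt_irrefl _)

/-- Two quartiles of different scales of the same parity whose `j`-th sub-tiles meet. -/
theorem Quartile.nested_of_lt {P P' : Quartile} {j : Fin 3} (hpar : P.k % 2 = P'.k % 2)
    (hk : P.k < P'.k) (h : ¬ Disjoint (P.sub j).rect (P'.sub j).rect) :
    P'.I ⊆ P.I ∧ ∀ i, (P.sub i).ω ⊆ (P'.sub j).ω := by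
  obtain ⟨⟨x, hx, hx'⟩, y, hy, hy'⟩ := not_disjoint_rect_iff.1 h
  refine ⟨dyadic_subset_of_mem (by omega) hx' hx, fun i => (P.sub_ω_subset i).trans ?_⟩
  -- Equal parity makes the scales differ by at least 2, so the whole quartile frequency interval,
  -- of length `2^(k+2)`, fits into one sub-tile of the finer scale.
  exact dyadic_subset_of_mem (by simp only [Quartile.sub]; omega) (P.sub_ω_subset j hy) hy'

theorem Quartile.eq_of_not_disjoint {P P' : Quartile} {j : Fin 3} (hk : P.k = P'.k)
    (h : ¬ Disjoint (P.sub j).rect (P'.sub j).rect) : P = P' := by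
  obtain ⟨⟨x, hx, hx'⟩, y, hy, hy'⟩ := not_disjoint_rect_iff.1 h
  simp only [Tile.I, Tile.ω, Quartile.sub, hk] at hx hx' hy hy'
  have h1 := eq_of_mem_dyadic hx hx'
  have h2 := eq_of_mem_dyadic hy hy'
  ext
  · exact hk
  · exact h1
  · norm_cast at h2; omega

theorem Quartile.meet_cases {P P' : Quartile} {j : Fin 3} (hpar : P.k % 2 = P'.k % 2)
    (h : ¬ Disjoint (P.sub j).rect (P'.sub j).rect) :
    P = P' ∨ (P'.I ⊆ P.I ∧ ∀ i, (P.sub i).ω ⊆ (P'.sub j).ω) ∨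
      (P.I ⊆ P'.I ∧ ∀ i, (P'.sub i).ω ⊆ (P.sub j).ω) := by
  rcases lt_trichotomy P.k P'.k with hk | hk | hk
  · exact Or.inr (Or.inl (nested_of_lt hpar hk h))
  · exact Or.inl (eq_of_not_disjoint hk h)
  · exact Or.inr (Or.inr (nested_of_lt hpar.symm hk (fun h' => h h'.symm)))

/-! ### Wave packets and their orthogonality. -/

theorem measurable_walsh (l : ℕ) : Measurable (walsh l) := by
  induction l using Nat.strong_induction_on with
  | _ l ih =>
    rcases Nat.eq_zero_or_pos l with rfl | hl
    · have : walsh 0 = (Set.Ico (0 : ℝ) 1).indicator (fun _ => 1) := funext walsh_zero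
      rw [this]
      exact measurable_const.indicator measurableSet_Ico
    · have h := ih (l / 2) (by omega)
      obtain h2 | h2 := Nat.mod_two_eq_zero_or_one l
      · have h3 : walsh l = fun x => walsh (l / 2) (2 * x) + walsh (l / 2) (2 * x - 1) := by
          funext x; rw [← walsh_two_mul]; congr 1; omega
        rw [h3]
        exact (h.comp (by fun_prop)).add (h.comp (by fun_prop))
      · have h3 : walsh l = fun x => walsh (l / 2) (2 * x) - walsh (l / 2) (2 * x - 1) := by
          funext x; rw [← walsh_two_mul_add_one]; congr 1; omega
        rw [h3]
        exact (h.comp (by fun_prop)).sub (h.comp (by fun_prop))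

theorem abs_walsh (l : ℕ) (x : ℝ) :
    |walsh l x| = (Set.Ico (0 : ℝ) 1).indicator (fun _ => 1) x := by
  induction l using Nat.strong_induction_on generalizing x with
  | _ l ih =>
    rcases Nat.eq_zero_or_pos l with rfl | hl
    · rw [walsh_zero, Set.indicator_apply]; split_ifs <;> simp
    · have h1 := ih (l / 2) (by omega) (2 * x)
      have h2 := ih (l / 2) (by omega) (2 * x - 1)
      simp only [Set.indicator_apply, Set.mem_Ico] at h1 h2 ⊢
      have key : |walsh l x| = |walsh (l / 2) (2 * x)| + |walsh (l / 2) (2 * x - 1)| := by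
        have h0 : walsh (l / 2) (2 * x) = 0 ∨ walsh (l / 2) (2 * x - 1) = 0 := by
          by_contra! hc
          rw [← abs_pos, ← abs_pos, h1, h2] at hc
          obtain ⟨hc1, hc2⟩ := hc
          split_ifs at hc1 hc2 with h3 h4
          all_goals linarith
        obtain h3 | h3 := Nat.mod_two_eq_zero_or_one l
        · have h4 : l = 2 * (l / 2) := by omega
          rw [h4, walsh_two_mul, ← h4]
          rcases h0 with h0 | h0 <;> simp [h0]
        · have h4 : l = 2 * (l / 2) + 1 := by omega
          rw [h4, walsh_two_mul_add_one, ← h4]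
          rcases h0 with h0 | h0 <;> simp [h0]
      rw [key, h1, h2]
      split_ifs <;> first | (exfalso; grind) | norm_num

theorem mem_dyadic_iff (k n : ℤ) (x : ℝ) :
    x ∈ dyadic (-k) n ↔ (2 : ℝ) ^ k * x - n ∈ Set.Ico (0 : ℝ) 1 := by
  have hp : (0 : ℝ) < 2 ^ k := by positivity
  rw [dyadic, zpow_neg, Set.mem_Ico, Set.mem_Ico, inv_mul_le_iff₀ hp, lt_inv_mul_iff₀ hp]
  constructor <;> rintro ⟨h1, h2⟩ <;> constructor <;> linarith

open Classical in
theorem Tile.norm_φ (s : Tile) (x : ℝ) :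
    ‖s.φ x‖ = s.I.indicator (fun _ => (2 : ℝ) ^ ((s.k : ℝ) / 2)) x := by
  rw [Tile.φ, Complex.norm_real, Real.norm_eq_abs, abs_mul, abs_walsh,
    abs_of_pos (by positivity), Set.indicator_apply, Set.indicator_apply, Tile.I]
  simp only [mem_dyadic_iff]
  split_ifs <;> simp

theorem Tile.measurable_φ (s : Tile) : Measurable s.φ := by
  unfold Tile.φ
  exact Complex.measurable_ofReal.comp
    (((measurable_walsh _).comp (by fun_prop)).const_mul _)

theorem Tile.memLp_φ (s : Tile) : MemLp s.φ 2 volume := by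
  have h : MemLp (s.I.indicator (fun _ : ℝ => (2 : ℝ) ^ ((s.k : ℝ) / 2))) 2 volume := by
    apply memLp_indicator_const 2 (measurableSet_dyadic _ _)
    right
    exact (volume_dyadic (-s.k) s.n).trans_ne ENNReal.ofReal_ne_top
  apply h.of_le s.measurable_φ.aestronglyMeasurable
  refine Filter.Eventually.of_forall fun x => ?_
  rw [s.norm_φ]
  exact le_abs_self _

/-- The wave packet of a tile as a vector of `L²`. -/
def Tile.vec (s : Tile) : Lp ℂ 2 (volume : Measure ℝ) := s.memLp_φ.toLp s.φ

theorem inner_vec_toLp (s : Tile) {f : ℝ → ℂ} (hf : MemLp f 2 volume) :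
    ⟪s.vec, hf.toLp f⟫_ℂ = pairing f s.φ := by
  rw [L2.inner_def, pairing]
  apply integral_congr_ae
  filter_upwards [s.memLp_φ.coeFn_toLp, hf.coeFn_toLp] with x h1 h2
  rw [Tile.vec, h1, h2]
  simp

theorem rpow_half_succ (k : ℤ) :
    (2 : ℝ) ^ ((k : ℝ) / 2) = (√2)⁻¹ * 2 ^ (((k + 1 : ℤ) : ℝ) / 2) := by
  rw [Real.sqrt_eq_rpow, ← Real.rpow_neg (by norm_num), ← Real.rpow_add (by norm_num)]
  congr 1; push_cast; ring

/-- A rectangle of area two splits into two tiles either in frequency or in time; the Walsh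
recursion is the change of basis between the two splittings. -/
theorem vec_two_mul (k n : ℤ) (l : ℕ) :
    (Tile.mk k n (2 * l)).vec =
      (((√2)⁻¹ : ℝ) : ℂ) • ((Tile.mk (k + 1) (2 * n) l).vec + (Tile.mk (k + 1) (2 * n + 1) l).vec) := by
  unfold Tile.vec
  rw [← MemLp.toLp_add, ← MemLp.toLp_const_smul]
  congr 1
  funext x
  simp only [Tile.φ, Pi.smul_apply, Pi.add_apply, smul_eq_mul]
  rw [rpow_half_succ, walsh_two_mul]
  have h1 : 2 * ((2 : ℝ) ^ k * x - n) = 2 ^ (k + 1) * x - ((2 * n : ℤ) : ℝ) := by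
    rw [zpow_add_one₀ two_ne_zero]; push_cast; ring
  have h2 : (2 : ℝ) ^ (k + 1) * x - ((2 * n : ℤ) : ℝ) - 1 =
      2 ^ (k + 1) * x - ((2 * n + 1 : ℤ) : ℝ) := by
    push_cast; ring
  rw [h1, h2]
  push_cast
  ring

theorem vec_two_mul_add_one (k n : ℤ) (l : ℕ) :
    (Tile.mk k n (2 * l + 1)).vec =
      (((√2)⁻¹ : ℝ) : ℂ) • ((Tile.mk (k + 1) (2 * n) l).vec - (Tile.mk (k + 1) (2 * n + 1) l).vec) := by
  unfold Tile.vec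
  rw [← MemLp.toLp_sub, ← MemLp.toLp_const_smul]
  congr 1
  funext x
  simp only [Tile.φ, Pi.smul_apply, Pi.sub_apply, smul_eq_mul]
  rw [rpow_half_succ, walsh_two_mul_add_one]
  have h1 : 2 * ((2 : ℝ) ^ k * x - n) = 2 ^ (k + 1) * x - ((2 * n : ℤ) : ℝ) := by
    rw [zpow_add_one₀ two_ne_zero]; push_cast; ring
  have h2 : (2 : ℝ) ^ (k + 1) * x - ((2 * n : ℤ) : ℝ) - 1 =
      2 ^ (k + 1) * x - ((2 * n + 1 : ℤ) : ℝ) := by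
    push_cast; ring
  rw [h1, h2]
  push_cast
  ring

theorem inner_vec_of_disjoint_I {s t : Tile} (h : ∀ x, x ∈ s.I → x ∉ t.I) :
    ⟪s.vec, t.vec⟫_ℂ = 0 := by
  nth_rw 2 [Tile.vec]
  rw [inner_vec_toLp, pairing]
  rw [integral_eq_zero_of_ae]
  refine Filter.Eventually.of_forall fun x => ?_
  by_cases hs : x ∈ s.I
  · have : t.φ x = 0 := by
      rw [← norm_eq_zero, t.norm_φ, Set.indicator_of_notMem (h x hs)]
    simp [this]
  · have : s.φ x = 0 := by
      rw [← norm_eq_zero, s.norm_φ, Set.indicator_of_notMem hs]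
    simp [this]

open Classical in
theorem inner_vec_self (s : Tile) : ⟪s.vec, s.vec⟫_ℂ = 1 := by
  nth_rw 2 [Tile.vec]
  rw [inner_vec_toLp, pairing]
  have : ∀ x, s.φ x * (starRingEnd ℂ) (s.φ x) =
      ((s.I.indicator (fun _ => (2 : ℝ) ^ s.k) x : ℝ) : ℂ) := by
    intro x
    rw [Complex.mul_conj, Complex.normSq_eq_norm_sq, s.norm_φ, Set.indicator_apply,
      Set.indicator_apply]
    congr 1
    split_ifs
    · rw [← Real.rpow_natCast, ← Real.rpow_mul (by norm_num), ← Real.rpow_intCast]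
      congr 1; push_cast; ring
    · simp
  simp only [this]
  rw [integral_complex_ofReal, integral_indicator (show MeasurableSet s.I from measurableSet_dyadic _ _),
    setIntegral_const, show volume.real s.I = 2 ^ (-s.k) from volume_real_dyadic _ _, smul_eq_mul, ← zpow_add₀ two_ne_zero]
  simp

theorem inner_vec_same_scale_ne_n {k n n' : ℤ} {l l' : ℕ} (h : n ≠ n') :
    ⟪(Tile.mk k n l).vec, (Tile.mk k n' l').vec⟫_ℂ = 0 :=
  inner_vec_of_disjoint_I fun _ hx hx' => h (eq_of_mem_dyadic hx hx')

/-- Split both packets into time halves and induct on `l + l'`. If the halved indices agree, the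
packets are the sum and the difference of the same two orthonormal vectors. -/
theorem inner_vec_same_scale_ne_l {k n : ℤ} {l l' : ℕ} (h : l ≠ l') :
    ⟪(Tile.mk k n l).vec, (Tile.mk k n l').vec⟫_ℂ = 0 := by
  induction hN : l + l' using Nat.strong_induction_on generalizing k n l l' with
  | _ N ih =>
    subst hN
    have hn1 : (2 * n : ℤ) ≠ 2 * n + 1 := by omega
    have key : ∀ a b : ℕ, l = 2 * a ∨ l = 2 * a + 1 → (l' = 2 * b ∨ l' = 2 * b + 1) →
        ⟪(Tile.mk k n l).vec, (Tile.mk k n l').vec⟫_ℂ = 0 := by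
      intro a b ha hb
      have hcross : ∀ (n n' : ℤ), n ≠ n' →
        ⟪(Tile.mk (k + 1) n a).vec, (Tile.mk (k + 1) n' b).vec⟫_ℂ = 0 :=
          fun n n' h => inner_vec_same_scale_ne_n h
      by_cases hab : a = b
      · subst hab
        rcases ha with rfl | rfl <;> rcases hb with rfl | rfl
        · exact absurd rfl h
        · rw [vec_two_mul, vec_two_mul_add_one, inner_smul_left, inner_smul_right, inner_add_left,
            inner_sub_right, inner_sub_right, hcross _ _ hn1, hcross _ _ hn1.symm,
            inner_vec_self, inner_vec_self]
          ring
        · rw [vec_two_mul, vec_two_mul_add_one, inner_smul_left, inner_smul_right, inner_sub_left,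
            inner_add_right, inner_add_right, hcross _ _ hn1, hcross _ _ hn1.symm,
            inner_vec_self, inner_vec_self]
          ring
        · exact absurd rfl h
      · have hz : ∀ n : ℤ, ⟪(Tile.mk (k + 1) n a).vec, (Tile.mk (k + 1) n b).vec⟫_ℂ = 0 := by
          exact fun n => ih (a + b) (by omega) hab rfl
        rcases ha with rfl | rfl <;> rcases hb with rfl | rfl <;>
        simp only [vec_two_mul, vec_two_mul_add_one, inner_smul_left, inner_smul_right,
          inner_sub_left, inner_add_left, inner_sub_right, inner_add_right, hcross _ _ hn1,
          hcross _ _ hn1.symm, hz] <;> ring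
    exact key (l / 2) (l' / 2) (by omega) (by omega)

/-- The packet with the longer time interval is split in time until the scales agree. The excluded
condition says exactly that the two tiles meet. -/
theorem inner_vec_scale {k : ℤ} {n n' : ℤ} {l l' : ℕ} (d : ℕ)
    (h : ¬ (n / 2 ^ d = n' ∧ l' / 2 ^ d = l)) :
    ⟪(Tile.mk (k + d) n l).vec, (Tile.mk k n' l').vec⟫_ℂ = 0 := by
  induction d generalizing k n' l' with
  | zero =>
    simp only [pow_zero, Int.ediv_one, Nat.div_one, Nat.cast_zero, add_zero] at h ⊢
    by_cases hn : n = n'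
    · subst hn
      exact inner_vec_same_scale_ne_l fun hl => h ⟨rfl, hl.symm⟩
    · exact inner_vec_same_scale_ne_n hn
  | succ d ih =>
    have hk : k + ((d + 1 : ℕ) : ℤ) = (k + 1) + (d : ℤ) := by push_cast; ring
    have hchild : ∀ r : ℤ, r = 0 ∨ r = 1 →
        ⟪(Tile.mk (k + 1 + (d : ℤ)) n l).vec, (Tile.mk (k + 1) (2 * n' + r) (l' / 2)).vec⟫_ℂ = 0 := by
      intro r hr
      apply ih
      rintro ⟨h1, h2⟩
      apply h
      rw [pow_succ, pow_succ, ← Int.ediv_ediv_of_nonneg (by positivity), h1]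
      refine ⟨by omega, ?_⟩
      rw [mul_comm, ← Nat.div_div_eq_div_mul, h2]
    have h0 := hchild 0 (Or.inl rfl)
    have h1 := hchild 1 (Or.inr rfl)
    rw [add_zero] at h0
    rw [hk]
    obtain hl | hl : l' = 2 * (l' / 2) ∨ l' = 2 * (l' / 2) + 1 := by omega
    · rw [hl, vec_two_mul, inner_smul_right, inner_add_right, h0, h1]; simp
    · rw [hl, vec_two_mul_add_one, inner_smul_right, inner_sub_right, h0, h1]; simp

theorem inner_vec_of_disjoint {s t : Tile} (h : Disjoint s.rect t.rect) :
    ⟪s.vec, t.vec⟫_ℂ = 0 := by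
  wlog hk : t.k ≤ s.k generalizing s t
  · rw [← inner_conj_symm, this h.symm (by omega), map_zero]
  obtain ⟨k, n, l⟩ := s
  obtain ⟨k', n', l'⟩ := t
  obtain ⟨d, rfl⟩ := Int.le.dest hk
  apply inner_vec_scale
  rintro ⟨h1, h2⟩
  refine not_disjoint_rect_iff.2 ⟨?_, ?_⟩ h
  · refine ⟨_, left_mem_dyadic _ _, ?_⟩
    have h3 := dyadic_subset_div (-(k' + d)) n d
    rw [h1] at h3
    have h4 := h3 (left_mem_dyadic _ _)
    rwa [neg_add, neg_add_cancel_right, ← neg_add] at h4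
  · refine ⟨_, ?_, left_mem_dyadic _ _⟩
    have h3 := dyadic_subset_div k' l' d
    have h5 : (l' : ℤ) / 2 ^ d = l := by exact_mod_cast h2
    rw [h5] at h3
    exact h3 (left_mem_dyadic _ _)

theorem orthonormal_vec {ι : Type*} (τ : ι → Tile) (D : Finset ι)
    (hD : (D : Set ι).Pairwise fun P P' => Disjoint (τ P).rect (τ P').rect) :
    Orthonormal ℂ (fun P : D => (τ P).vec) := by
  classical
  rw [orthonormal_iff_ite]
  intro P P'
  split_ifs with h
  · rw [h, inner_vec_self]
  · exact inner_vec_of_disjoint (hD P.2 P'.2 fun h' => h (Subtype.ext h'))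

/-- Bessel's inequality for the wave packets of pairwise disjoint tiles. -/
theorem sum_norm_inner_vec_le {ι : Type*} (τ : ι → Tile) (D : Finset ι)
    (hD : (D : Set ι).Pairwise fun P P' => Disjoint (τ P).rect (τ P').rect)
    (F : Lp ℂ 2 (volume : Measure ℝ)) :
    ∑ P ∈ D, ‖⟪(τ P).vec, F⟫_ℂ‖ ^ 2 ≤ ‖F‖ ^ 2 := by
  have := (orthonormal_vec τ D hD).sum_inner_products_le F (s := Finset.univ)
  rwa [Finset.sum_coe_sort D (fun P => ‖⟪(τ P).vec, F⟫_ℂ‖ ^ 2)] at this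

theorem norm_sum_vec_sq {ι : Type*} (τ : ι → Tile) (D : Finset ι)
    (hD : (D : Set ι).Pairwise fun P P' => Disjoint (τ P).rect (τ P').rect) (b : ι → ℂ) :
    ‖∑ P ∈ D, b P • (τ P).vec‖ ^ 2 = ∑ P ∈ D, ‖b P‖ ^ 2 := by
  have h := (orthonormal_vec τ D hD).inner_sum (fun P => b P) (fun P => b P) Finset.univ
  rw [Finset.sum_coe_sort D (fun P => b P • (τ P).vec), inner_self_eq_norm_sq_to_K,
    Finset.sum_coe_sort D (fun P => (starRingEnd ℂ) (b P) * b P)] at h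
  have h2 : ∀ P, (starRingEnd ℂ) (b P) * b P = ((‖b P‖ ^ 2 : ℝ) : ℂ) := by
    intro P; rw [Complex.conj_mul']; push_cast; rfl
  simp only [h2] at h
  rw [← Complex.ofReal_sum] at h
  refine Complex.ofReal_injective (Eq.trans ?_ h)
  push_cast
  rfl

/-! ### Trees and their greedy selection. -/

open Classical in
/-- The members of `R` whose time interval lies in `I_{P₀}` and whose `i`-th sub-tile has the
frequency `ξ`. -/
def tree (R : Finset Quartile) (i : Fin 3) (P₀ : Quartile) (ξ : ℝ) : Finset Quartile :=
  R.filter fun P => P.I ⊆ P₀.I ∧ ξ ∈ (P.sub i).ω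

open Classical in
/-- The members of `R` lying in an `i`-tree with the given top, for some `i`. -/
def fullTree (R : Finset Quartile) (P₀ : Quartile) (ξ : ℝ) : Finset Quartile :=
  R.filter fun P => P.I ⊆ P₀.I ∧ ∃ i, ξ ∈ (P.sub i).ω

theorem mem_tree {R : Finset Quartile} {i : Fin 3} {P₀ P : Quartile} {ξ : ℝ} :
    P ∈ tree R i P₀ ξ ↔ P ∈ R ∧ P.I ⊆ P₀.I ∧ ξ ∈ (P.sub i).ω := by
  classical rw [tree, Finset.mem_filter]

theorem mem_fullTree {R : Finset Quartile} {P₀ P : Quartile} {ξ : ℝ} :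
    P ∈ fullTree R P₀ ξ ↔ P ∈ R ∧ P.I ⊆ P₀.I ∧ ∃ i, ξ ∈ (P.sub i).ω := by
  classical rw [fullTree, Finset.mem_filter]

theorem tree_subset (R : Finset Quartile) (i : Fin 3) (P₀ : Quartile) (ξ : ℝ) :
    tree R i P₀ ξ ⊆ R := fun _ h => (mem_tree.1 h).1

theorem tree_mono {R R' : Finset Quartile} (h : R ⊆ R') (i : Fin 3) (P₀ : Quartile) (ξ : ℝ) :
    tree R i P₀ ξ ⊆ tree R' i P₀ ξ := fun _ hP =>
  mem_tree.2 ⟨h (mem_tree.1 hP).1, (mem_tree.1 hP).2⟩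

theorem tree_subset_fullTree (R : Finset Quartile) (i : Fin 3) (P₀ : Quartile) (ξ : ℝ) :
    tree R i P₀ ξ ⊆ fullTree R P₀ ξ := fun P h => by
  rw [mem_tree] at h
  exact mem_fullTree.2 ⟨h.1, h.2.1, i, h.2.2⟩

/-- In an `i`-tree the `j`-th sub-tiles, `j ≠ i`, are pairwise disjoint. -/
theorem tree_pairwise_disjoint {R : Finset Quartile} {r : ℤ} (hR : ∀ P ∈ R, P.k % 2 = r)
    {i j : Fin 3} (hij : i ≠ j) (P₀ : Quartile) (ξ : ℝ) :
    (tree R i P₀ ξ : Set Quartile).Pairwise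
      fun P P' => Disjoint (P.sub j).rect (P'.sub j).rect := by
  intro P hP P' hP' hne
  rw [Finset.mem_coe, mem_tree] at hP hP'
  by_contra hd
  rcases Quartile.meet_cases ((hR P hP.1).trans (hR P' hP'.1).symm) hd with h | h | h
  · exact hne h
  -- Nesting would put `ξ` into the `j`-th sub-tile of a quartile whose `i`-th sub-tile already
  -- contains it.
  · exact hij (Quartile.sub_index_eq hP'.2.2 (h.2 i hP.2.2))
  · exact hij (Quartile.sub_index_eq hP.2.2 (h.2 i hP'.2.2))

/-- The trees of type `i ≠ j` with tops from `Ps × Ξ` have mean square `j`-coefficient at most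
`s`. -/
def SizeLe (Ps : Finset Quartile) (Ξ : Finset ℝ) (R : Finset Quartile) (i : Fin 3)
    (a : Quartile → ℝ) (s : ℝ) : Prop :=
  ∀ P₀ ∈ Ps, ∀ ξ ∈ Ξ, ∑ P ∈ tree R i P₀ ξ, a P ^ 2 ≤ s ^ 2 * volume.real P₀.I

theorem SizeLe.mono {Ps R R' : Finset Quartile} {Ξ : Finset ℝ} {i : Fin 3} {a : Quartile → ℝ}
    {s : ℝ} (h : SizeLe Ps Ξ R i a s) (hR : R' ⊆ R) : SizeLe Ps Ξ R' i a s := fun P₀ hP ξ hξ =>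
  (Finset.sum_le_sum_of_subset_of_nonneg (tree_mono hR _ _ _) fun _ _ _ => sq_nonneg _).trans
    (h P₀ hP ξ hξ)

/-- The sign orients the frequency axis so that one greedy argument serves both `i < j` and `i > j`.
-/
theorem sign_lt {i j : Fin 3} (hij : i ≠ j) : ∃ σ : ℝ, ∀ (P : Quartile) (x y : ℝ),
    x ∈ (P.sub i).ω → y ∈ (P.sub j).ω → σ * x < σ * y := by
  rcases lt_or_gt_of_ne hij with h | h
  · exact ⟨1, fun P x y hx hy => by have := P.lt_of_mem_sub h hx hy; linarith⟩
  · exact ⟨-1, fun P x y hx hy => by have := P.lt_of_mem_sub h hy hx; linarith⟩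

open Classical in
/-- Greedy selection of trees: away from a part of small size, `w` is controlled by the energy. -/
theorem exists_selection {Ps R₀ : Finset Quartile} {Ξ : Finset ℝ} {r : ℤ}
    (hpar : ∀ P ∈ R₀, P.k % 2 = r) {i j : Fin 3} (hij : i ≠ j) (a w : Quartile → ℝ) {s B : ℝ}
    (hB : 0 ≤ B)
    (hw : ∀ R ⊆ R₀, ∀ P₀ ∈ Ps, ∀ ξ ∈ Ξ, ∑ P ∈ fullTree R P₀ ξ, w P ≤ B * volume.real P₀.I)
    {σ : ℝ} (hσ : ∀ (P : Quartile) (x y : ℝ), x ∈ (P.sub i).ω → y ∈ (P.sub j).ω → σ * x < σ * y) :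
    ∀ R ⊆ R₀, ∃ R' ⊆ R, ∃ D ⊆ R, SizeLe Ps Ξ R' i a s ∧
      (D : Set Quartile).Pairwise (fun P P' => Disjoint (P.sub j).rect (P'.sub j).rect) ∧
      (∀ P ∈ D, ∃ ξ ∈ Ξ, ξ ∈ (P.sub i).ω ∧
        ∃ P₀ ∈ Ps, s ^ 2 * volume.real P₀.I < ∑ P ∈ tree R i P₀ ξ, a P ^ 2) ∧
      s ^ 2 * ∑ P ∈ R \ R', w P ≤ B * ∑ P ∈ D, a P ^ 2 := by
  classical
  intro R
  induction R using Finset.strongInduction with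
  | _ R ih =>
  intro hRR
  let bad : ℝ → Prop := fun ξ =>
    ∃ P₀ ∈ Ps, s ^ 2 * volume.real P₀.I < ∑ P ∈ tree R i P₀ ξ, a P ^ 2
  by_cases hbad : (Ξ.filter bad).Nonempty
  -- Among the frequencies violating the size bound, take the one extremal in the direction from the
  -- `i`-th to the `j`-th sub-tile. Only the `i`-tree at this top enters `D`, but the full tree is
  -- removed.
  · obtain ⟨ξ₀, hξ₀, hmax⟩ := Finset.exists_max_image _ (fun ξ => σ * ξ) hbad
    rw [Finset.mem_filter] at hξ₀
    obtain ⟨hξ₀, P₀, hP₀, hlt⟩ := hξ₀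
    set T := tree R i P₀ ξ₀ with hT
    set U := fullTree R P₀ ξ₀ with hU
    have hTU : T ⊆ U := tree_subset_fullTree _ _ _ _
    have hUR : U ⊆ R := Finset.filter_subset _ _
    have hTne : T.Nonempty := by
      by_contra hne
      rw [Finset.not_nonempty_iff_eq_empty] at hne
      rw [hne, Finset.sum_empty] at hlt
      have := P₀.volume_real_I_pos
      nlinarith [sq_nonneg s]
    have hss : R \ U ⊂ R := Finset.sdiff_ssubset hUR (hTne.mono hTU)
    obtain ⟨R', hR', D, hD, hsize, hdisj, hξD, hsum⟩ := ih (R \ U) hss (hss.subset.trans hRR)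
    have hDT : Disjoint T D := by
      rw [Finset.disjoint_left]
      exact fun P hP hP' => (Finset.mem_sdiff.1 (hD hP')).2 (hTU hP)
    have hcross : ∀ P ∈ T, ∀ P' ∈ D, Disjoint (P.sub j).rect (P'.sub j).rect := by
      intro P hP P' hP'
      obtain ⟨hPR, hPI, hPξ⟩ := mem_tree.1 hP
      obtain ⟨hPR', hPU'⟩ := Finset.mem_sdiff.1 (hD hP')
      -- If `P'` is the narrower quartile in time, it lies in the full tree already removed. If it
      -- is the wider one, its own violating frequency lies in the `j`-th sub-tile of `P`, beyond
      -- `ξ₀`, against extremality; this is why the induction records such a frequency for every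
      -- member of `D`.
      by_contra hd
      rcases Quartile.meet_cases ((hpar P (hRR hPR)).trans (hpar P' (hRR hPR')).symm) hd
        with h | h | h
      · exact hPU' (h ▸ hTU hP)
      · exact hPU' (mem_fullTree.2 ⟨hPR', h.1.trans hPI, j, h.2 i hPξ⟩)
      · obtain ⟨ξ, hξ, hξP, P₁, hP₁, hlt₁⟩ := hξD P' hP'
        have h1 := hσ P _ _ hPξ (h.2 i hξP)
        refine absurd (hmax ξ (Finset.mem_filter.2 ⟨hξ, P₁, hP₁, hlt₁.trans_le ?_⟩)) h1.not_ge
        exact Finset.sum_le_sum_of_subset_of_nonneg (tree_mono hss.subset _ _ _)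
          fun _ _ _ => sq_nonneg _
    refine ⟨R', hR'.trans hss.subset, T ∪ D, Finset.union_subset (tree_subset _ _ _ _)
      (hD.trans hss.subset), hsize, ?_, ?_, ?_⟩
    · rw [Finset.coe_union, Set.pairwise_union]
      exact ⟨tree_pairwise_disjoint (fun P hP => hpar P (hRR hP)) hij _ _, hdisj,
        fun P hP P' hP' _ => ⟨hcross P hP P' hP', (hcross P hP P' hP').symm⟩⟩
    · intro P hP
      rcases Finset.mem_union.1 hP with hP | hP
      · exact ⟨ξ₀, hξ₀, (mem_tree.1 hP).2.2, P₀, hP₀, hlt⟩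
      · obtain ⟨ξ, hξ, hξP, P₁, hP₁, hlt₁⟩ := hξD P hP
        exact ⟨ξ, hξ, hξP, P₁, hP₁, hlt₁.trans_le
          (Finset.sum_le_sum_of_subset_of_nonneg (tree_mono hss.subset _ _ _)
            fun _ _ _ => sq_nonneg _)⟩
    · have hsplit : R \ R' = U ∪ ((R \ U) \ R') := by
        ext P
        simp only [Finset.mem_sdiff, Finset.mem_union]
        constructor
        · rintro ⟨h1, h2⟩
          by_cases hPU : P ∈ U
          · exact Or.inl hPU
          · exact Or.inr ⟨⟨h1, hPU⟩, h2⟩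
        · rintro (h | h)
          · exact ⟨hUR h, fun h' => (Finset.mem_sdiff.1 (hR' h')).2 h⟩
          · exact ⟨h.1.1, h.2⟩
      have hdj : Disjoint U ((R \ U) \ R') := by
        rw [Finset.disjoint_left]
        exact fun P hP hP' => (Finset.mem_sdiff.1 (Finset.mem_sdiff.1 hP').1).2 hP
      rw [hsplit, Finset.sum_union hdj, Finset.sum_union hDT, mul_add, mul_add]
      refine add_le_add ?_ hsum
      calc s ^ 2 * ∑ P ∈ U, w P ≤ s ^ 2 * (B * volume.real P₀.I) :=
            mul_le_mul_of_nonneg_left (hw R hRR P₀ hP₀ ξ₀ hξ₀) (sq_nonneg s)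
        _ = B * (s ^ 2 * volume.real P₀.I) := by ring
        _ ≤ B * ∑ P ∈ T, a P ^ 2 := mul_le_mul_of_nonneg_left hlt.le hB
  · refine ⟨R, subset_rfl, ∅, Finset.empty_subset _, ?_, by simp, by simp, by simp⟩
    intro P₀ hP₀ ξ hξ
    by_contra hlt
    exact hbad ⟨ξ, Finset.mem_filter.2 ⟨hξ, P₀, hP₀, not_le.1 hlt⟩⟩

/-! ### The tree estimate. -/

/-- The summand of the trilinear form. -/
def triWeight (a : Fin 3 → Quartile → ℝ) (P : Quartile) : ℝ :=
  1 / (volume.real P.I) ^ (1 / 2 : ℝ) * a 0 P * a 1 P * a 2 P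

/-- One factor is taken out in the supremum norm, where it absorbs `|I_P|^{-1/2}`; Cauchy–Schwarz
handles the other two. -/
theorem sum_three_le {R : Finset Quartile} (u v v' : Quartile → ℝ) {s t t' A : ℝ}
    (hs : 0 ≤ s) (ht : 0 ≤ t) (ht' : 0 ≤ t') (hA : 0 ≤ A)
    (hv : ∀ P, 0 ≤ v P) (hv' : ∀ P, 0 ≤ v' P)
    (h : ∀ P ∈ R, u P ≤ s * (volume.real P.I) ^ (1 / 2 : ℝ))
    (h1 : ∑ P ∈ R, v P ^ 2 ≤ t ^ 2 * A) (h2 : ∑ P ∈ R, v' P ^ 2 ≤ t' ^ 2 * A) :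
    ∑ P ∈ R, 1 / (volume.real P.I) ^ (1 / 2 : ℝ) * u P * v P * v' P ≤ s * t * t' * A := by
  have hcs : ∑ P ∈ R, v P * v' P ≤ t * t' * A := by
    have h3 := Finset.sum_mul_sq_le_sq_mul_sq R v v'
    refine abs_le_of_sq_le_sq' ?_ (by positivity) |>.2
    calc (∑ P ∈ R, v P * v' P) ^ 2 ≤ (t ^ 2 * A) * (t' ^ 2 * A) :=
          h3.trans (mul_le_mul h1 h2 (Finset.sum_nonneg fun _ _ => sq_nonneg _) (by positivity))
      _ = (t * t' * A) ^ 2 := by ring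
  calc ∑ P ∈ R, 1 / (volume.real P.I) ^ (1 / 2 : ℝ) * u P * v P * v' P
      ≤ ∑ P ∈ R, s * (v P * v' P) := by
        apply Finset.sum_le_sum
        intro P hP
        have hpos : 0 < (volume.real P.I) ^ (1 / 2 : ℝ) :=
          Real.rpow_pos_of_pos P.volume_real_I_pos _
        have : 1 / (volume.real P.I) ^ (1 / 2 : ℝ) * u P ≤ s := by
          rw [one_div, inv_mul_le_iff₀ hpos, mul_comm]; exact h P hP
        rw [mul_assoc]
        exact mul_le_mul_of_nonneg_right this (mul_nonneg (hv P) (hv' P))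
    _ = s * ∑ P ∈ R, v P * v' P := by rw [Finset.mul_sum]
    _ ≤ s * (t * t' * A) := mul_le_mul_of_nonneg_left hcs hs
    _ = s * t * t' * A := by ring

/-- The quartile belongs to the tree of which it is itself the top. -/
theorem SizeLe.le_single {Ps R : Finset Quartile} {Ξ : Finset ℝ} {i : Fin 3} {a : Quartile → ℝ}
    {s : ℝ} (h : SizeLe Ps Ξ R i a s) (hR : R ⊆ Ps) (hs : 0 ≤ s) {P : Quartile} (hP : P ∈ R)
    (hΞ : ∃ ξ ∈ Ξ, ξ ∈ (P.sub i).ω) : a P ≤ s * (volume.real P.I) ^ (1 / 2 : ℝ) := by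
  obtain ⟨ξ, hξ, hξP⟩ := hΞ
  have h1 := h P (hR hP) ξ hξ
  have h2 : a P ^ 2 ≤ ∑ P ∈ tree R i P ξ, a P ^ 2 :=
    Finset.single_le_sum (f := fun P => a P ^ 2) (fun _ _ => sq_nonneg _)
      (mem_tree.2 ⟨hP, subset_rfl, hξP⟩)
  refine abs_le_of_sq_le_sq' ?_ (by positivity) |>.2
  rw [mul_pow, ← Real.sqrt_eq_rpow, Real.sq_sqrt P.volume_real_I_pos.le]
  exact h2.trans h1

theorem sum_le_sum_sum_of_cover {ι α : Type*} {A : Finset α} (s : Finset ι) (t : ι → Finset α)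
    (hA : ∀ x ∈ A, ∃ i ∈ s, x ∈ t i) {w : α → ℝ} (hw : ∀ x, 0 ≤ w x) :
    ∑ x ∈ A, w x ≤ ∑ i ∈ s, ∑ x ∈ t i, w x := by
  classical
  calc ∑ x ∈ A, w x ≤ ∑ x ∈ A, ∑ i ∈ s, if x ∈ t i then w x else 0 := by
        apply Finset.sum_le_sum
        intro x hx
        obtain ⟨i, hi, hxi⟩ := hA x hx
        refine le_trans (by simp [hxi]) (Finset.single_le_sum
          (f := fun i => if x ∈ t i then w x else 0) (fun j _ => ?_) hi)
        have := hw x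
        positivity
    _ = ∑ i ∈ s, ∑ x ∈ A with x ∈ t i, w x := by
        rw [Finset.sum_comm]
        simp only [Finset.sum_filter]
    _ ≤ ∑ i ∈ s, ∑ x ∈ t i, w x := by
        apply Finset.sum_le_sum
        intro i _
        exact Finset.sum_le_sum_of_subset_of_nonneg (fun x hx => (Finset.mem_filter.1 hx).2)
          fun _ _ _ => hw _

theorem sum_fullTree_le (R : Finset Quartile) (P₀ : Quartile) (ξ : ℝ) {w : Quartile → ℝ}
    (hw : ∀ P, 0 ≤ w P) :
    ∑ P ∈ fullTree R P₀ ξ, w P ≤ ∑ i, ∑ P ∈ tree R i P₀ ξ, w P := by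
  refine sum_le_sum_sum_of_cover _ _ (fun P hP => ?_) hw
  obtain ⟨h1, h2, i, h3⟩ := mem_fullTree.1 hP
  exact ⟨i, Finset.mem_univ _, mem_tree.2 ⟨h1, h2, h3⟩⟩

theorem triWeight_nonneg {a : Fin 3 → Quartile → ℝ} (ha : ∀ j P, 0 ≤ a j P) (P : Quartile) :
    0 ≤ triWeight a P := by
  unfold triWeight
  have := ha 0 P; have := ha 1 P; have := ha 2 P
  positivity

/-- The tree estimate. -/
theorem sum_triWeight_fullTree_le {Ps R : Finset Quartile} {Ξ : Finset ℝ} (hR : R ⊆ Ps)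
    (hΞ : ∀ P ∈ Ps, ∀ i, ∃ ξ ∈ Ξ, ξ ∈ (P.sub i).ω) (a : Fin 3 → Quartile → ℝ)
    (ha : ∀ j P, 0 ≤ a j P) {s : Fin 3 → ℝ} (hs : ∀ j, 0 ≤ s j)
    (hsize : ∀ i j, i ≠ j → SizeLe Ps Ξ R i (a j) (s j)) {P₀ : Quartile} (hP₀ : P₀ ∈ Ps) {ξ : ℝ}
    (hξ : ξ ∈ Ξ) :
    ∑ P ∈ fullTree R P₀ ξ, triWeight a P ≤ 3 * (s 0 * s 1 * s 2) * volume.real P₀.I := by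
  have hA := P₀.volume_real_I_pos.le
  have hsingle : ∀ j, ∀ P ∈ R, a j P ≤ s j * (volume.real P.I) ^ (1 / 2 : ℝ) := by
    intro j P hP
    obtain ⟨i, hij⟩ := exists_ne j
    exact (hsize i j hij).le_single hR (hs j) hP (hΞ P (hR hP) i)
  have htree : ∀ i, ∑ P ∈ tree R i P₀ ξ, triWeight a P ≤ (s 0 * s 1 * s 2) * volume.real P₀.I := by
    intro i
    have hu : ∀ P ∈ tree R i P₀ ξ, a i P ≤ s i * (volume.real P.I) ^ (1 / 2 : ℝ) :=
      fun P hP => hsingle i P (tree_subset _ _ _ _ hP)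
    have key : ∀ j j', i ≠ j → i ≠ j' →
        ∑ P ∈ tree R i P₀ ξ, 1 / (volume.real P.I) ^ (1 / 2 : ℝ) * a i P * a j P * a j' P ≤
          s i * s j * s j' * volume.real P₀.I := fun j j' hj hj' =>
      sum_three_le (a i) (a j) (a j') (hs i) (hs j) (hs j') hA (ha j) (ha j') hu
        (hsize i j hj P₀ hP₀ ξ hξ) (hsize i j' hj' P₀ hP₀ ξ hξ)
    unfold triWeight
    obtain rfl | rfl | rfl : i = 0 ∨ i = 1 ∨ i = 2 := by omega
    · exact key 1 2 (by decide) (by decide)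
    · exact le_of_eq_of_le (Finset.sum_congr rfl fun P _ => by ring)
        ((key 0 2 (by decide) (by decide)).trans_eq (by ring))
    · exact le_of_eq_of_le (Finset.sum_congr rfl fun P _ => by ring)
        ((key 0 1 (by decide) (by decide)).trans_eq (by ring))
  calc _ ≤ ∑ i, ∑ P ∈ tree R i P₀ ξ, triWeight a P := sum_fullTree_le _ _ _ (triWeight_nonneg ha)
    _ ≤ ∑ i : Fin 3, (s 0 * s 1 * s 2) * volume.real P₀.I := Finset.sum_le_sum fun i _ => htree i
    _ = _ := by simp; ring

/-! ### Numerical inequalities for summing over levels. -/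

theorem min_le_rpow_mul_rpow {x y p : ℝ} (hx : 0 < x) (hy : 0 < y) (hp0 : 0 ≤ p) (hp1 : p ≤ 1) :
    min x y ≤ x ^ (1 - p) * y ^ p := by
  have hm : 0 < min x y := lt_min hx hy
  calc min x y = min x y ^ (1 - p) * min x y ^ p := by
        rw [← Real.rpow_add hm]; simp
    _ ≤ _ := mul_le_mul (Real.rpow_le_rpow hm.le (min_le_left _ _) (by linarith))
        (Real.rpow_le_rpow hm.le (min_le_right _ _) hp0) (by positivity) (by positivity)

/-- The two minima are interpolated with exponents `(1-θ)c` and `θc`. The parameter `c` stays free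
so that values on either side of 1 give decay on either side of `t = x^{1-θ} y^θ`. -/
theorem min_mul_min_div_le {t x y θ c : ℝ} (ht : 0 < t) (hx : 0 < x) (hy : 0 < y) (hθ0 : 0 < θ)
    (hθ1 : θ < 1) (hc : 0 ≤ c) (h1 : (1 - θ) * c ≤ 1) (h2 : θ * c ≤ 1) :
    min t x * min t y / t ≤
      x ^ (1 - θ) * y ^ θ * (t / (x ^ (1 - θ) * y ^ θ)) ^ (1 - c) := by
  have hs : 0 < x ^ (1 - θ) * y ^ θ := by positivity
  have e1 := min_le_rpow_mul_rpow ht hx (p := (1 - θ) * c) (mul_nonneg (by linarith) hc) h1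
  have e2 := min_le_rpow_mul_rpow ht hy (p := θ * c) (by positivity) h2
  rw [div_le_iff₀ ht]
  refine (mul_le_mul e1 e2 (le_min ht.le hy.le) (by positivity)).trans_eq ?_
  have e3 : x ^ ((1 - θ) * c) * y ^ (θ * c) = (x ^ (1 - θ) * y ^ θ) ^ c := by
    rw [Real.mul_rpow (by positivity) (by positivity), ← Real.rpow_mul hx.le,
      ← Real.rpow_mul hy.le]
  have e4 : t ^ (1 - (1 - θ) * c) * t ^ (1 - θ * c) = t ^ (1 - c) * t := by
    rw [← Real.rpow_add ht, ← Real.rpow_add_one ht.ne']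
    congr 1; ring
  set s := x ^ (1 - θ) * y ^ θ
  rw [Real.div_rpow ht.le hs.le]
  calc _ = (t ^ (1 - (1 - θ) * c) * t ^ (1 - θ * c)) * (x ^ ((1 - θ) * c) * y ^ (θ * c)) := by ring
    _ = t ^ (1 - c) * t * s ^ c := by rw [e3, e4]
    _ = _ := by
      have : s ^ c * s ^ (1 - c) = s := by rw [← Real.rpow_add hs]; simp
      have h3 : s ^ (1 - c) ≠ 0 := by positivity
      field_simp
      linarith

/-- Replaces a two-sided geometric series by a telescoping one: the bounded increasing function
`y/(1+y)` drops by a comparable amount from `y` to `qy`. -/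
theorem min_inv_le_telescope {y q : ℝ} (hy : 0 < y) (hq0 : 0 < q) (hq1 : q < 1) :
    min y y⁻¹ ≤ 4 / (1 - q) * (y / (1 + y) - q * y / (1 + q * y)) := by
  have h1 : 0 < 1 - q := by linarith
  have h2 : 0 < 1 + q * y := by positivity
  have e : 4 / (1 - q) * (y / (1 + y) - q * y / (1 + q * y)) = 4 * y / ((1 + y) * (1 + q * y)) := by
    field_simp
    ring
  rw [e, le_div_iff₀ (by positivity)]
  have hqy : q * y ≤ y := by nlinarith
  have hle : (1 + y) * (1 + q * y) ≤ (1 + y) * (1 + y) := by gcongr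
  rcases le_total y 1 with h | h
  · calc _ ≤ y * ((1 + y) * (1 + y)) := mul_le_mul (min_le_left _ _) hle (by positivity) hy.le
      _ ≤ y * 4 := by gcongr; nlinarith
      _ = _ := by ring
  · calc _ ≤ y⁻¹ * ((1 + y) * (1 + y)) :=
          mul_le_mul (min_le_right _ _) hle (by positivity) (by positivity)
      _ ≤ y⁻¹ * (4 * y * y) := mul_le_mul_of_nonneg_left (by nlinarith) (by positivity)
      _ = _ := by field_simp

/-- With `δ = min θ (1-θ)`, the choices `c = 1 ∓ δ` bound the loss by the powers `±δ` of `t/s`,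
where `s = x^{1-θ} y^θ`; then telescope with `q = 2^{-δ}`. -/
theorem min_mul_min_div_le_telescope {t x y θ : ℝ} (ht : 0 < t) (hx : 0 < x) (hy : 0 < y)
    (hθ0 : 0 < θ) (hθ1 : θ < 1) :
    min t x * min t y / t ≤ 4 / (1 - (1 / 2) ^ min θ (1 - θ)) * (x ^ (1 - θ) * y ^ θ) *
      ((t / (x ^ (1 - θ) * y ^ θ)) ^ min θ (1 - θ) /
          (1 + (t / (x ^ (1 - θ) * y ^ θ)) ^ min θ (1 - θ)) -
        (t / 2 / (x ^ (1 - θ) * y ^ θ)) ^ min θ (1 - θ) /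
          (1 + (t / 2 / (x ^ (1 - θ) * y ^ θ)) ^ min θ (1 - θ))) := by
  have hδ0 : 0 < min θ (1 - θ) := lt_min hθ0 (by linarith)
  have hδ1 : min θ (1 - θ) ≤ θ := min_le_left _ _
  have hδ2 : min θ (1 - θ) ≤ 1 - θ := min_le_right _ _
  set δ := min θ (1 - θ)
  have hs : 0 < x ^ (1 - θ) * y ^ θ := by positivity
  have k1 := min_mul_min_div_le (c := 1 - δ) ht hx hy hθ0 hθ1 (by linarith) (by nlinarith)
    (by nlinarith)
  have k2 := min_mul_min_div_le (c := 1 + δ) ht hx hy hθ0 hθ1 (by linarith) (by nlinarith)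
    (by nlinarith)
  set s := x ^ (1 - θ) * y ^ θ
  rw [show 1 - (1 - δ) = δ by ring] at k1
  rw [show 1 - (1 + δ) = -δ by ring, Real.rpow_neg (by positivity)] at k2
  have hq0 : (0 : ℝ) < (1 / 2) ^ δ := by positivity
  have hq1 : ((1 : ℝ) / 2) ^ δ < 1 := Real.rpow_lt_one (by norm_num) (by norm_num) hδ0
  have hyq : (t / 2 / s) ^ δ = (1 / 2) ^ δ * (t / s) ^ δ := by
    rw [← Real.mul_rpow (by positivity) (by positivity)]; congr 1; ring
  have hy' : 0 < (t / s) ^ δ := by positivity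
  rw [hyq]
  calc min t x * min t y / t ≤ s * min ((t / s) ^ δ) ((t / s) ^ δ)⁻¹ := by
        rw [mul_min_of_nonneg _ _ hs.le]
        exact le_min k1 k2
    _ ≤ s * _ := mul_le_mul_of_nonneg_left (min_inv_le_telescope hy' hq0 hq1) hs.le
    _ = _ := by ring

/-! ### Iteration over levels and the trilinear estimate. -/

section Iteration

variable {Ps : Finset Quartile} {Ξ : Finset ℝ} {r : ℤ}

open Classical in
/-- Simultaneous selection for a set of pairs `(i, j)`. -/
theorem exists_selection_pairs (hpar : ∀ P ∈ Ps, P.k % 2 = r)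
    (hΞ : ∀ P ∈ Ps, ∀ i, ∃ ξ ∈ Ξ, ξ ∈ (P.sub i).ω) {a : Fin 3 → Quartile → ℝ}
    (ha : ∀ j P, 0 ≤ a j P) {E : Fin 3 → ℝ} (hE0 : ∀ j, 0 < E j)
    (hE : ∀ j, ∀ D ⊆ Ps, (D : Set Quartile).Pairwise
      (fun P P' => Disjoint (P.sub j).rect (P'.sub j).rect) → ∑ P ∈ D, a j P ^ 2 ≤ E j ^ 2)
    {s : Fin 3 → ℝ} (hs : ∀ j, 0 ≤ s j) {R : Finset Quartile} (hR : R ⊆ Ps)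
    (hsize : ∀ i j, i ≠ j → SizeLe Ps Ξ R i (a j) (s j)) (t : ℝ)
    (L : Finset (Fin 3 × Fin 3)) (hL : ∀ p ∈ L, p.1 ≠ p.2) :
    ∃ R' ⊆ R, (∀ p ∈ L, SizeLe Ps Ξ R' p.1 (a p.2) (t * E p.2)) ∧
      t ^ 2 * ∑ P ∈ R \ R', triWeight a P ≤ L.card * (3 * (s 0 * s 1 * s 2)) := by
  induction L using Finset.induction_on with
  | empty => exact ⟨R, subset_rfl, by simp, by simp⟩
  | insert p L hp ih =>
    obtain ⟨R₁, hR₁, hsize₁, hsum₁⟩ := ih fun p hp => hL p (Finset.mem_insert_of_mem hp)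
    have hij := hL p (Finset.mem_insert_self _ _)
    obtain ⟨σ, hσ⟩ := sign_lt hij
    have hB : 0 ≤ 3 * (s 0 * s 1 * s 2) := by
      have := hs 0; have := hs 1; have := hs 2
      positivity
    obtain ⟨R', hR', D, hD, hsz, hdisj, -, hsum⟩ := exists_selection (Ps := Ps) (Ξ := Ξ)
      (R₀ := R₁) (s := t * E p.2) (fun P hP => hpar P (hR (hR₁ hP))) hij (a p.2) (triWeight a) hB
      (fun R₂ h₂ P₀ hP₀ ξ hξ => sum_triWeight_fullTree_le (h₂.trans (hR₁.trans hR)) hΞ a ha hs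
        (fun i j h => (hsize i j h).mono (h₂.trans hR₁)) hP₀ hξ) hσ R₁ subset_rfl
    refine ⟨R', hR'.trans hR₁, ?_, ?_⟩
    · intro p' hp'
      rcases Finset.mem_insert.1 hp' with rfl | hp'
      · exact hsz
      · exact (hsize₁ p' hp').mono hR'
    · have hEp := hE0 p.2
      -- The threshold `t * E` contributes a factor `E²` that cancels the energy bound for the
      -- selected family.
      have h1 : t ^ 2 * ∑ P ∈ R₁ \ R', triWeight a P ≤ 3 * (s 0 * s 1 * s 2) := by
        have h2 := hsum.trans (mul_le_mul_of_nonneg_left (hE p.2 D (hD.trans (hR₁.trans hR)) hdisj)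
          hB)
        refine le_of_mul_le_mul_right ?_ (pow_pos hEp 2)
        linarith
      have hsplit : R \ R' = (R \ R₁) ∪ (R₁ \ R') := by
        ext P
        simp only [Finset.mem_sdiff, Finset.mem_union]
        have := @hR₁ P
        have := @hR' P
        tauto
      have hdj : Disjoint (R \ R₁) (R₁ \ R') := by
        rw [Finset.disjoint_left]
        exact fun P h1 h2 => (Finset.mem_sdiff.1 h1).2 (Finset.mem_sdiff.1 h2).1
      rw [hsplit, Finset.sum_union hdj, Finset.card_insert_of_notMem hp, mul_add]
      push_cast
      linarith

theorem SizeLe.min {R : Finset Quartile} {i : Fin 3} {a : Quartile → ℝ} {s s' : ℝ}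
    (h : SizeLe Ps Ξ R i a s) (h' : SizeLe Ps Ξ R i a s') : SizeLe Ps Ξ R i a (min s s') := by
  rcases min_choice s s' with e | e <;> rw [e] <;> assumption

/-- Each halving of `t` costs at most the drop of the telescoping function, with constant `288 = 72
· 4`. The crude remainder scales like `t³`, hence gains `1/8` per halving and disappears as `N`
grows. -/
theorem sum_triWeight_iterate {θ : ℝ} (hθ0 : 0 < θ) (hθ1 : θ < 1)
    (hpar : ∀ P ∈ Ps, P.k % 2 = r)
    (hΞ : ∀ P ∈ Ps, ∀ i, ∃ ξ ∈ Ξ, ξ ∈ (P.sub i).ω) {a : Fin 3 → Quartile → ℝ}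
    (ha : ∀ j P, 0 ≤ a j P) {E : Fin 3 → ℝ} (hE0 : ∀ j, 0 < E j)
    (hE : ∀ j, ∀ D ⊆ Ps, (D : Set Quartile).Pairwise
      (fun P P' => Disjoint (P.sub j).rect (P'.sub j).rect) → ∑ P ∈ D, a j P ^ 2 ≤ E j ^ 2)
    {x y : ℝ} (hx : 0 < x) (hy : 0 < y)
    (hS₁ : ∀ i, i ≠ 1 → SizeLe Ps Ξ Ps i (a 1) (x * E 1))
    (hS₂ : ∀ i, i ≠ 2 → SizeLe Ps Ξ Ps i (a 2) (y * E 2)) (N : ℕ) :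
    ∀ R ⊆ Ps, ∀ t : ℝ, 0 < t → (∀ i j, i ≠ j → SizeLe Ps Ξ R i (a j) (t * E j)) →
      ∑ P ∈ R, triWeight a P ≤ E 0 * E 1 * E 2 *
        (288 / (1 - (1 / 2) ^ min θ (1 - θ)) * (x ^ (1 - θ) * y ^ θ) *
          ((t / (x ^ (1 - θ) * y ^ θ)) ^ min θ (1 - θ) /
            (1 + (t / (x ^ (1 - θ) * y ^ θ)) ^ min θ (1 - θ))) +
          t ^ 3 * (1 / 8) ^ N * ∑ P ∈ Ps, volume.real P.I) := by
  classical
  have hEp : 0 < E 0 * E 1 * E 2 := mul_pos (mul_pos (hE0 0) (hE0 1)) (hE0 2)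
  have hδ0 : 0 < min θ (1 - θ) := lt_min hθ0 (by linarith)
  have hq1 : ((1 : ℝ) / 2) ^ min θ (1 - θ) < 1 := Real.rpow_lt_one (by norm_num) (by norm_num) hδ0
  have hs : 0 < x ^ (1 - θ) * y ^ θ := by positivity
  induction N with
  | zero =>
    intro R hR t ht hsize
    have h1 : ∑ P ∈ R, triWeight a P ≤ ∑ P ∈ Ps, E 0 * E 1 * E 2 * t ^ 3 * volume.real P.I := by
      refine (Finset.sum_le_sum fun P hP => ?_).trans
        (Finset.sum_le_sum_of_subset_of_nonneg hR fun P _ _ => ?_)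
      · have hb : ∀ j, a j P ≤ t * E j * (volume.real P.I) ^ (1 / 2 : ℝ) := by
          intro j
          obtain ⟨i, hij⟩ := exists_ne j
          exact (hsize i j hij).le_single hR (mul_pos ht (hE0 j)).le hP (hΞ P (hR hP) i)
        have hI := P.volume_real_I_pos
        have h3 : 0 < (volume.real P.I) ^ (1 / 2 : ℝ) := by positivity
        have h4 : (volume.real P.I) ^ (1 / 2 : ℝ) * (volume.real P.I) ^ (1 / 2 : ℝ) =
            volume.real P.I := by
          rw [← Real.rpow_add hI]; norm_num
        have := hE0 0; have := hE0 1; have := hE0 2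
        have := ha 0 P; have := ha 1 P; have := ha 2 P
        unfold triWeight
        set v := (volume.real P.I) ^ (1 / 2 : ℝ)
        calc 1 / v * a 0 P * a 1 P * a 2 P ≤ 1 / v * (t * E 0 * v) * (t * E 1 * v) * (t * E 2 * v) := by
              gcongr <;> exact hb _
          _ = E 0 * E 1 * E 2 * t ^ 3 * (v * v) := by field_simp
          _ = _ := by rw [h4]
      · have := P.volume_real_I_pos
        positivity
    refine h1.trans ?_
    rw [← Finset.mul_sum, mul_assoc]
    refine mul_le_mul_of_nonneg_left ?_ hEp.le
    rw [pow_zero, mul_one]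
    have : 0 < 1 - ((1 : ℝ) / 2) ^ min θ (1 - θ) := by linarith
    have h0 : 0 ≤ 288 / (1 - (1 / 2) ^ min θ (1 - θ)) * (x ^ (1 - θ) * y ^ θ) *
          ((t / (x ^ (1 - θ) * y ^ θ)) ^ min θ (1 - θ) /
            (1 + (t / (x ^ (1 - θ) * y ^ θ)) ^ min θ (1 - θ))) := by positivity
    linarith
  | succ N ih =>
    intro R hR t ht hsize
    -- The a priori sizes help only in the last two positions; in the first, the current level is
    -- the only bound.
    let s : Fin 3 → ℝ := ![t * E 0, min (t * E 1) (x * E 1), min (t * E 2) (y * E 2)]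
    have hs0 : ∀ j, 0 ≤ s j := by
      have := hE0 0; have := hE0 1; have := hE0 2
      intro j
      obtain rfl | rfl | rfl : j = 0 ∨ j = 1 ∨ j = 2 := by omega
      all_goals simp only [s, Matrix.cons_val]
      all_goals positivity
    have hss : ∀ i j, i ≠ j → SizeLe Ps Ξ R i (a j) (s j) := by
      intro i j hij
      obtain rfl | rfl | rfl : j = 0 ∨ j = 1 ∨ j = 2 := by omega
      · exact hsize i 0 hij
      · exact (hsize i 1 hij).min ((hS₁ i hij).mono hR)
      · exact (hsize i 2 hij).min ((hS₂ i hij).mono hR)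
    obtain ⟨R', hR', hsize', hsum⟩ := exists_selection_pairs hpar hΞ ha hE0 hE hs0 hR hss (t / 2)
      (Finset.univ.filter fun p => p.1 ≠ p.2) (fun p hp => (Finset.mem_filter.1 hp).2)
    have hcard : (Finset.univ.filter fun p : Fin 3 × Fin 3 => p.1 ≠ p.2).card = 6 := by
      decide
    have ih' := ih R' (hR'.trans hR) (t / 2) (by positivity)
      fun i j hij => hsize' (i, j) (Finset.mem_filter.2 ⟨Finset.mem_univ _, hij⟩)
    -- Here `72 = 4 · 6 · 3`: the square of `t/2`, the six ordered pairs of distinct indices, and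
    -- the constant of the tree estimate.
    have hsumE : ∑ P ∈ R \ R', triWeight a P ≤
        E 0 * E 1 * E 2 * (72 * (min t x * min t y / t)) := by
      have e1 : s 1 = min t x * E 1 := (min_mul_of_nonneg _ _ (hE0 1).le).symm
      have e2 : s 2 = min t y * E 2 := (min_mul_of_nonneg _ _ (hE0 2).le).symm
      have e0 : s 0 = t * E 0 := rfl
      rw [e0, e1, e2] at hsum
      rw [← mul_div_assoc, ← mul_div_assoc, le_div_iff₀ ht]
      refine le_of_mul_le_mul_right ?_ ht
      have : ((Finset.univ.filter fun p : Fin 3 × Fin 3 => p.1 ≠ p.2).card : ℝ) = 6 := by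
        exact_mod_cast hcard
      rw [this] at hsum
      linarith
    have htel := min_mul_min_div_le_telescope ht hx hy hθ0 hθ1
    rw [← Finset.sum_sdiff hR']
    refine (add_le_add hsumE ih').trans ?_
    rw [← mul_add]
    refine mul_le_mul_of_nonneg_left ?_ hEp.le
    have e : (t / 2) ^ 3 * (1 / 8 : ℝ) ^ N = t ^ 3 * (1 / 8) ^ (N + 1) := by ring
    rw [e, ← add_assoc]
    refine add_le_add ?_ le_rfl
    refine (add_le_add (mul_le_mul_of_nonneg_left htel (by norm_num : (0 : ℝ) ≤ 72)) le_rfl).trans_eq ?_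
    ring

end Iteration

/-- The trilinear estimate for quartiles with scales of one parity. -/
theorem sum_triWeight_le {θ : ℝ} (hθ0 : 0 < θ) (hθ1 : θ < 1) {Ps : Finset Quartile} {r : ℤ}
    (hpar : ∀ P ∈ Ps, P.k % 2 = r) {a : Fin 3 → Quartile → ℝ}
    (ha : ∀ j P, 0 ≤ a j P) {E : Fin 3 → ℝ} (hE0 : ∀ j, 0 < E j)
    (hE : ∀ j, ∀ D ⊆ Ps, (D : Set Quartile).Pairwise
      (fun P P' => Disjoint (P.sub j).rect (P'.sub j).rect) → ∑ P ∈ D, a j P ^ 2 ≤ E j ^ 2)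
    {S₁ S₂ : ℝ} (hS₁0 : 0 < S₁) (hS₂0 : 0 < S₂)
    (hS₁ : ∀ i, i ≠ 1 → ∀ P₀ ∈ Ps, ∀ ξ, ∑ P ∈ tree Ps i P₀ ξ, a 1 P ^ 2 ≤ S₁ ^ 2 * volume.real P₀.I)
    (hS₂ : ∀ i, i ≠ 2 → ∀ P₀ ∈ Ps, ∀ ξ, ∑ P ∈ tree Ps i P₀ ξ, a 2 P ^ 2 ≤ S₂ ^ 2 * volume.real P₀.I) :
    ∑ P ∈ Ps, triWeight a P ≤ 288 / (1 - (1 / 2) ^ min θ (1 - θ)) * E 0 *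
      ((E 2 * S₁) ^ (1 - θ) * (E 1 * S₂) ^ θ) := by
  classical
  -- One frequency in each sub-tile suffices, and finiteness lets the greedy selection take an
  -- extremal one.
  let Ξ : Finset ℝ := (Ps ×ˢ (Finset.univ : Finset (Fin 3))).image
    fun p => (2 : ℝ) ^ p.1.k * (((p.1.sub p.2).l : ℤ) : ℝ)
  have hΞ : ∀ P ∈ Ps, ∀ i, ∃ ξ ∈ Ξ, ξ ∈ (P.sub i).ω := fun P hP i =>
    ⟨_, Finset.mem_image.2 ⟨(P, i), by simpa using hP, rfl⟩, left_mem_dyadic _ _⟩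
  have h0 := hE0 0
  have h1 := hE0 1
  have h2 := hE0 2
  have hδ0 : 0 < min θ (1 - θ) := lt_min hθ0 (by linarith)
  have hq1 : ((1 : ℝ) / 2) ^ min θ (1 - θ) < 1 := Real.rpow_lt_one (by norm_num) (by norm_num) hδ0
  have hq2 : 0 < 1 - ((1 : ℝ) / 2) ^ min θ (1 - θ) := by linarith
  -- The starting level `t` is so large that `t² |I_P| ≥ 1` for every `P`; then every size is at
  -- most `t` times the energy.
  have hIpos : ∀ P ∈ Ps, 0 ≤ (volume.real (P : Quartile).I)⁻¹ := fun P _ =>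
    (inv_pos.2 P.volume_real_I_pos).le
  set t : ℝ := 1 + ∑ P ∈ Ps, (volume.real P.I)⁻¹ with ht
  have hsum0 : 0 ≤ ∑ P ∈ Ps, (volume.real P.I)⁻¹ := Finset.sum_nonneg hIpos
  have ht1 : 1 ≤ t := by linarith
  have hsize : ∀ i j, i ≠ j → SizeLe Ps Ξ Ps i (a j) (t * E j) := by
    intro i j hij P₀ hP₀ ξ hξ
    refine (hE j _ (tree_subset _ _ _ _) (tree_pairwise_disjoint hpar hij P₀ ξ)).trans ?_
    have hI := P₀.volume_real_I_pos
    have h3 : (volume.real P₀.I)⁻¹ ≤ t := by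
      have := Finset.single_le_sum (f := fun P : Quartile => (volume.real P.I)⁻¹) hIpos hP₀
      linarith
    have h4 : 1 ≤ t * volume.real P₀.I := by
      rwa [inv_le_iff_one_le_mul₀ hI] at h3
    have h5 : 1 ≤ t ^ 2 * volume.real P₀.I := by nlinarith
    have := sq_nonneg (E j)
    nlinarith
  have hx : 0 < S₁ / E 1 := by positivity
  have hy : 0 < S₂ / E 2 := by positivity
  have key : ∀ N : ℕ, _ := fun N => sum_triWeight_iterate hθ0 hθ1 hpar hΞ ha hE0 hE hx hy
    (fun i hi P₀ hP₀ ξ _ => by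
      rw [div_mul_cancel₀ _ h1.ne']; exact hS₁ i hi P₀ hP₀ ξ)
    (fun i hi P₀ hP₀ ξ _ => by
      rw [div_mul_cancel₀ _ h2.ne']; exact hS₂ i hi P₀ hP₀ ξ) N Ps subset_rfl t (by linarith) hsize
  have hlim := ge_of_tendsto' (((((tendsto_pow_atTop_nhds_zero_of_lt_one (r := (1 / 8 : ℝ))
    (by norm_num) (by norm_num)).const_mul (t ^ 3)).mul_const
      (∑ P ∈ Ps, volume.real P.I)).const_add _).const_mul (E 0 * E 1 * E 2)) key
  refine hlim.trans ?_
  rw [mul_zero, zero_mul, add_zero]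
  have hs : 0 < (S₁ / E 1) ^ (1 - θ) * (S₂ / E 2) ^ θ := by positivity
  have hψ : (t / ((S₁ / E 1) ^ (1 - θ) * (S₂ / E 2) ^ θ)) ^ min θ (1 - θ) /
      (1 + (t / ((S₁ / E 1) ^ (1 - θ) * (S₂ / E 2) ^ θ)) ^ min θ (1 - θ)) ≤ 1 := by
    have : 0 < (t / ((S₁ / E 1) ^ (1 - θ) * (S₂ / E 2) ^ θ)) ^ min θ (1 - θ) := by positivity
    rw [div_le_one (by positivity)]
    linarith
  have e1 : E 1 * E 2 * ((S₁ / E 1) ^ (1 - θ) * (S₂ / E 2) ^ θ) =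
      (E 2 * S₁) ^ (1 - θ) * (E 1 * S₂) ^ θ := by
    rw [Real.div_rpow hS₁0.le h1.le, Real.div_rpow hS₂0.le h2.le, Real.mul_rpow h2.le hS₁0.le,
      Real.mul_rpow h1.le hS₂0.le]
    have k1 : E 1 ^ (1 - θ) * E 1 ^ θ = E 1 := by rw [← Real.rpow_add h1]; simp
    have k2 : E 2 ^ (1 - θ) * E 2 ^ θ = E 2 := by rw [← Real.rpow_add h2]; simp
    have : 0 < E 1 ^ (1 - θ) := by positivity
    have : 0 < E 2 ^ θ := by positivity
    nth_rw 1 [← k1]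
    nth_rw 1 [← k2]
    field_simp
  calc _ ≤ E 0 * E 1 * E 2 * (288 / (1 - (1 / 2) ^ min θ (1 - θ)) *
        ((S₁ / E 1) ^ (1 - θ) * (S₂ / E 2) ^ θ) * 1) := by gcongr
    _ = 288 / (1 - (1 / 2) ^ min θ (1 - θ)) * E 0 *
        (E 1 * E 2 * ((S₁ / E 1) ^ (1 - θ) * (S₂ / E 2) ^ θ)) := by ring
    _ = _ := by rw [e1]

/-! ### The convex function used in the size estimate. -/

/-- The convex function equal to `t ^ 2` on `[0, c]` and continued affinely. -/
def huber (c t : ℝ) : ℝ := 2 * t * min t c - min t c ^ 2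

/-- These affine functions are the tangents of `t²` at points `s ≤ c`, and `huber` is their upper
envelope; this is the form in which convexity is used. -/
theorem affine_le_huber {c t s : ℝ} (hs : s ≤ c) : 2 * t * s - s ^ 2 ≤ huber c t := by
  unfold huber
  rcases le_total t c with h | h
  · rw [min_eq_left h]; nlinarith [sq_nonneg (t - s)]
  · rw [min_eq_right h]; nlinarith [mul_nonneg (sub_nonneg.2 hs) (by linarith : 0 ≤ 2 * t - c - s)]

theorem huber_le_sq (c t : ℝ) : huber c t ≤ t ^ 2 := by
  unfold huber; nlinarith [sq_nonneg (t - min t c)]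

theorem huber_of_le {c t : ℝ} (h : t ≤ c) : huber c t = t ^ 2 := by
  unfold huber; rw [min_eq_left h]; ring

theorem huber_le_linear {c t : ℝ} (ht : 0 ≤ t) : huber c t ≤ 2 * c * t := by
  unfold huber
  nlinarith [mul_le_mul_of_nonneg_left (min_le_right t c) ht, sq_nonneg (min t c)]

theorem huber_le_average {c t : ℝ} (hc : 0 ≤ c) (ht : 0 ≤ t) (u : ℕ → ℝ)
    (h : t ≤ 1 / 4 * ∑ q ∈ Finset.range 4, u q) :
    huber c t ≤ 1 / 4 * ∑ q ∈ Finset.range 4, huber c (u q) := by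
  have hm : 0 ≤ min t c := le_min ht hc
  have h1 : ∑ q ∈ Finset.range 4, (2 * u q * min t c - min t c ^ 2) ≤
      ∑ q ∈ Finset.range 4, huber c (u q) :=
    Finset.sum_le_sum fun q _ => affine_le_huber (min_le_right t c)
  rw [Finset.sum_sub_distrib, ← Finset.sum_mul, ← Finset.mul_sum] at h1
  simp only [Finset.sum_const, Finset.card_range, nsmul_eq_mul] at h1
  have h2 := mul_le_mul_of_nonneg_right h hm
  unfold huber at h1 ⊢
  push_cast at h1
  linarith

/-! ### Wave packet coefficients across two scales. -/

section Coefficients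

variable (F : Lp ℂ 2 (volume : Measure ℝ))

/-- The wave packet coefficient on the tile with parameters `k`, `n`, `l`. -/
def coeff (k n : ℤ) (l : ℕ) : ℂ := ⟪(Tile.mk k n l).vec, F⟫_ℂ

theorem coeff_two_mul (k n : ℤ) (l : ℕ) : coeff F k n (2 * l) =
    (((√2)⁻¹ : ℝ) : ℂ) * (coeff F (k + 1) (2 * n) l + coeff F (k + 1) (2 * n + 1) l) := by
  rw [coeff, vec_two_mul, inner_smul_left, inner_add_left, Complex.conj_ofReal]; rfl

theorem coeff_two_mul_add_one (k n : ℤ) (l : ℕ) : coeff F k n (2 * l + 1) =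
    (((√2)⁻¹ : ℝ) : ℂ) * (coeff F (k + 1) (2 * n) l - coeff F (k + 1) (2 * n + 1) l) := by
  rw [coeff, vec_two_mul_add_one, inner_smul_left, inner_sub_left, Complex.conj_ofReal]; rfl

/-- Two steps of the Walsh recursion: four tiles stacked in frequency against four side by side in
time. -/
theorem coeff_four_mul (k n : ℤ) (l : ℕ) :
    coeff F k n (4 * l) = 1 / 2 * (coeff F (k + 2) (4 * n) l + coeff F (k + 2) (4 * n + 1) l +
      coeff F (k + 2) (4 * n + 2) l + coeff F (k + 2) (4 * n + 3) l) ∧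
    coeff F k n (4 * l + 1) = 1 / 2 * (coeff F (k + 2) (4 * n) l + coeff F (k + 2) (4 * n + 1) l -
      coeff F (k + 2) (4 * n + 2) l - coeff F (k + 2) (4 * n + 3) l) ∧
    coeff F k n (4 * l + 2) = 1 / 2 * (coeff F (k + 2) (4 * n) l - coeff F (k + 2) (4 * n + 1) l +
      coeff F (k + 2) (4 * n + 2) l - coeff F (k + 2) (4 * n + 3) l) ∧
    coeff F k n (4 * l + 3) = 1 / 2 * (coeff F (k + 2) (4 * n) l - coeff F (k + 2) (4 * n + 1) l -
      coeff F (k + 2) (4 * n + 2) l + coeff F (k + 2) (4 * n + 3) l) := by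
  have h2 : (((√2)⁻¹ : ℝ) : ℂ) * (((√2)⁻¹ : ℝ) : ℂ) = 1 / 2 := by
    rw [← Complex.ofReal_mul, ← mul_inv, Real.mul_self_sqrt (by norm_num)]; norm_num
  have e0 : 4 * l = 2 * (2 * l) := by ring
  have e1 : 4 * l + 1 = 2 * (2 * l) + 1 := by ring
  have e2 : 4 * l + 2 = 2 * (2 * l + 1) := by ring
  have e3 : 4 * l + 3 = 2 * (2 * l + 1) + 1 := by ring
  have k2 : k + 1 + 1 = k + 2 := by ring
  have n0 : 2 * (2 * n) = 4 * n := by ring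
  have n2 : 2 * (2 * n + 1) = 4 * n + 2 := by ring
  have n3 : 4 * n + 2 + 1 = 4 * n + 3 := by ring
  rw [e3, e2, e1, e0]
  simp only [coeff_two_mul, coeff_two_mul_add_one, k2, n0, n2, n3, ← h2]
  refine ⟨?_, ?_, ?_, ?_⟩ <;> ring

theorem norm_coeff_four_le (k n : ℤ) (L : ℕ) :
    ‖coeff F k n L‖ ≤ 1 / 2 * ∑ q ∈ Finset.range 4, ‖coeff F (k + 2) (4 * n + (q : ℕ)) (L / 4)‖ := by
  obtain ⟨h0, h1, h2, h3⟩ := coeff_four_mul F k n (L / 4)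
  have h4 : ∀ A B C D : ℂ, ‖A + B + C + D‖ ≤ ‖A‖ + ‖B‖ + ‖C‖ + ‖D‖ := fun A B C D =>
    norm_add₄_le
  have h5 : ‖(1 / 2 : ℂ)‖ = 1 / 2 := by norm_num
  have hL : L = 4 * (L / 4) ∨ L = 4 * (L / 4) + 1 ∨ L = 4 * (L / 4) + 2 ∨ L = 4 * (L / 4) + 3 := by
    omega
  have hsum : ∑ q ∈ Finset.range 4, ‖coeff F (k + 2) (4 * n + (q : ℕ)) (L / 4)‖ =
      ‖coeff F (k + 2) (4 * n) (L / 4)‖ + ‖coeff F (k + 2) (4 * n + 1) (L / 4)‖ +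
      ‖coeff F (k + 2) (4 * n + 2) (L / 4)‖ + ‖coeff F (k + 2) (4 * n + 3) (L / 4)‖ := by
    simp [Finset.sum_range_succ]
  rw [hsum]
  set A := coeff F (k + 2) (4 * n) (L / 4)
  set B := coeff F (k + 2) (4 * n + 1) (L / 4)
  set C := coeff F (k + 2) (4 * n + 2) (L / 4)
  set D := coeff F (k + 2) (4 * n + 3) (L / 4)
  rcases hL with hL | hL | hL | hL <;> rw [hL]
  · rw [h0, norm_mul, h5]; gcongr; exact h4 A B C D
  · rw [h1, norm_mul, h5]; gcongr; simpa [sub_eq_add_neg] using h4 A B (-C) (-D)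
  · rw [h2, norm_mul, h5]; gcongr; simpa [sub_eq_add_neg] using h4 A (-B) C (-D)
  · rw [h3, norm_mul, h5]; gcongr; simpa [sub_eq_add_neg] using h4 A (-B) (-C) D

/-- The 4 × 4 sign matrix with factor `1/2` is orthogonal. -/
theorem sum_norm_coeff_four (k n : ℤ) (l : ℕ) :
    ∑ m ∈ Finset.range 4, ‖coeff F k n (4 * l + m)‖ ^ 2 =
      ∑ q ∈ Finset.range 4, ‖coeff F (k + 2) (4 * n + (q : ℕ)) l‖ ^ 2 := by
  obtain ⟨h0, h1, h2, h3⟩ := coeff_four_mul F k n l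
  simp only [Finset.sum_range_succ, Finset.sum_range_zero, Nat.cast_zero, Nat.cast_one, add_zero,
    Nat.cast_ofNat, zero_add, h0, h1, h2, h3, ← Complex.normSq_eq_norm_sq]
  simp only [Complex.normSq_apply, Complex.mul_re, Complex.mul_im, Complex.add_re, Complex.add_im,
    Complex.sub_re, Complex.sub_im, Complex.div_ofNat_re, Complex.div_ofNat_im, Complex.one_re,
    Complex.one_im]
  ring

theorem norm_coeff_sq_add_le (k n : ℤ) (l : ℕ) {i j : Fin 3} (hij : i ≠ j) :
    ‖coeff F k n (4 * l + j)‖ ^ 2 + ‖coeff F k n (4 * l + i)‖ ^ 2 ≤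
      ∑ q ∈ Finset.range 4, ‖coeff F (k + 2) (4 * n + (q : ℕ)) l‖ ^ 2 := by
  rw [← sum_norm_coeff_four]
  have hne : (j : ℕ) ≠ i := fun h => hij (Fin.ext h.symm)
  rw [← Finset.sum_pair (f := fun m => ‖coeff F k n (4 * l + m)‖ ^ 2) hne]
  refine Finset.sum_le_sum_of_subset_of_nonneg ?_ fun _ _ _ => sq_nonneg _
  intro m hm
  have := i.2
  have := j.2
  simp only [Finset.mem_insert, Finset.mem_singleton] at hm
  rw [Finset.mem_range]
  omega

end Coefficients

/-! ### The size estimate by induction on scales. -/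

theorem floor_div_zpow_add_two (ξ : ℝ) (k : ℤ) :
    ⌊ξ / (2 : ℝ) ^ (k + 2)⌋₊ = ⌊ξ / (2 : ℝ) ^ k⌋₊ / 4 := by
  rw [← Nat.floor_div_ofNat, zpow_add₀ two_ne_zero, div_div]
  norm_num

theorem floor_of_mem_dyadic {ξ : ℝ} {k : ℤ} {l : ℕ} (h : ξ ∈ dyadic k l) :
    ⌊ξ / (2 : ℝ) ^ k⌋₊ = l := by
  have hp : (0 : ℝ) < 2 ^ k := by positivity
  obtain ⟨h1, h2⟩ := h
  have h3 : (l : ℝ) ≤ ξ / 2 ^ k := by rw [le_div_iff₀ hp]; push_cast at h1; linarith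
  rw [Nat.floor_eq_iff (le_trans (by positivity) h3)]
  refine ⟨h3, ?_⟩
  rw [div_lt_iff₀ hp]; push_cast at h2; linarith

/-- A quartile strictly inside `I(k, n)` lies in one of its quarters, up to parity. -/
theorem exists_quarter {P : Quartile} {k n : ℤ} (hpar : P.k % 2 = k % 2) (hne : P.k ≠ k)
    (h : P.I ⊆ dyadic (-k) n) :
    ∃ q ∈ Finset.range 4, P.I ⊆ dyadic (-(k + 2)) (4 * n + (q : ℕ)) := by
  have hle := le_of_dyadic_subset h
  obtain ⟨d, hd⟩ := Int.le.dest (show k + 2 ≤ P.k by omega)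
  have h1 := dyadic_subset_div (-P.k) P.n d
  have e1 : -P.k + (d : ℤ) = -(k + 2) := by omega
  rw [e1] at h1
  have h2 := dyadic_subset_div (-(k + 2)) (P.n / 2 ^ d) 2
  have e2 : -(k + 2) + ((2 : ℕ) : ℤ) = -k := by push_cast; ring
  rw [e2] at h2
  have hx := left_mem_dyadic (-P.k) P.n
  have h3 := eq_of_mem_dyadic (h2 (h1 hx)) (h hx)
  refine ⟨(P.n / 2 ^ d - 4 * n).toNat, ?_, ?_⟩
  · rw [Finset.mem_range]; omega
  · have : 4 * n + ((P.n / 2 ^ d - 4 * n).toNat : ℤ) = P.n / 2 ^ d := by omega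
    rw [this]; exact h1

theorem half_rpow_sq (k : ℤ) : ((2 : ℝ) ^ ((k : ℝ) / 2)) ^ 2 = 2 ^ k := by
  rw [← Real.rpow_natCast, ← Real.rpow_mul (by norm_num), ← Real.rpow_intCast]
  congr 1; push_cast; ring

theorem half_rpow_add_two (k : ℤ) :
    (2 : ℝ) ^ (((k + 2 : ℤ) : ℝ) / 2) = 2 * 2 ^ ((k : ℝ) / 2) := by
  rw [show ((k + 2 : ℤ) : ℝ) / 2 = 1 + (k : ℝ) / 2 by push_cast; ring, Real.rpow_add (by norm_num),
    Real.rpow_one]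

/-- The size of the wave packet coefficients is controlled by the averages of `|f|` over the time
intervals of the collection. -/
theorem sum_tree_coeff_add_huber_le (F : Lp ℂ 2 (volume : Measure ℝ)) {M : ℤ → ℤ → ℝ}
    (hM : ∀ (k n : ℤ) (l : ℕ), ‖coeff F k n l‖ ≤ (2 : ℝ) ^ ((k : ℝ) / 2) * M k n)
    (hM4 : ∀ k n, M k n = ∑ q ∈ Finset.range 4, M (k + 2) (4 * n + (q : ℕ)))
    (hM0 : ∀ k n, 0 ≤ M k n)
    {Ps : Finset Quartile} {r : ℤ} (hpar : ∀ P ∈ Ps, P.k % 2 = r) {d : ℝ} (hd : 0 ≤ d)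
    (hPd : ∀ P ∈ Ps, M P.k P.n ≤ d * (2 : ℝ) ^ (-P.k)) {i j : Fin 3} (hij : i ≠ j) (ξ : ℝ) {K : ℤ}
    (hK : ∀ P ∈ Ps, P.k < K) (N : ℕ) : ∀ k n : ℤ, k % 2 = r → K ≤ k + 2 * N →
    ∑ P ∈ tree Ps i ⟨k, n, 0⟩ ξ, ‖coeff F P.k P.n (4 * P.l + j)‖ ^ 2 +
      (2 : ℝ) ^ (-k) *
        huber (4 * d) ((2 : ℝ) ^ ((k : ℝ) / 2) * ‖coeff F k n ⌊ξ / (2 : ℝ) ^ k⌋₊‖) ≤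
      8 * d * M k n := by
  classical
  have hu : ∀ (k n : ℤ) (l : ℕ), (2 : ℝ) ^ ((k : ℝ) / 2) * ‖coeff F k n l‖ ≤ 2 ^ k * M k n := by
    intro k n l
    have h := mul_le_mul_of_nonneg_left (hM k n l) (by positivity : (0 : ℝ) ≤ 2 ^ ((k : ℝ) / 2))
    rw [← mul_assoc, ← sq, half_rpow_sq] at h
    exact h
  have hpow : ∀ k : ℤ, (2 : ℝ) ^ (-k) * 2 ^ k = 1 := fun k => by
    rw [← zpow_add₀ two_ne_zero]; simp
  have hsq : ∀ (k n : ℤ) (l : ℕ), ‖coeff F k n l‖ ^ 2 =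
      (2 : ℝ) ^ (-k) * ((2 : ℝ) ^ ((k : ℝ) / 2) * ‖coeff F k n l‖) ^ 2 := by
    intro k n l
    rw [mul_pow, half_rpow_sq, ← mul_assoc, hpow, one_mul]
  induction N with
  | zero =>
    intro k n _ hk
    -- Below the finest scale of the collection the linear bound on `huber` suffices, with constant
    -- `8d = 2 · 4d`.
    have hempty : tree Ps i ⟨k, n, 0⟩ ξ = ∅ := by
      rw [Finset.eq_empty_iff_forall_notMem]
      intro P hP
      obtain ⟨h1, h2, -⟩ := mem_tree.1 hP
      have := le_of_dyadic_subset h2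
      have := hK P h1
      simp only at *
      omega
    rw [hempty, Finset.sum_empty, zero_add]
    have h1 := (huber_le_linear (c := 4 * d) (t := (2 : ℝ) ^ ((k : ℝ) / 2) *
      ‖coeff F k n ⌊ξ / (2 : ℝ) ^ k⌋₊‖) (by positivity)).trans
        (mul_le_mul_of_nonneg_left (hu k n _) (by positivity))
    refine (mul_le_mul_of_nonneg_left h1 (by positivity : (0 : ℝ) ≤ 2 ^ (-k))).trans_eq ?_
    linear_combination (8 * d * M k n) * hpow k
  | succ N ih =>
    intro k n hk hKk
    have ihs := Finset.sum_le_sum fun (q : ℕ) (_ : q ∈ Finset.range 4) =>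
      ih (k + 2) (4 * n + (q : ℕ)) (by omega) (by push_cast at hKk; omega)
    rw [Finset.sum_add_distrib, ← Finset.mul_sum, ← Finset.mul_sum, ← hM4,
      floor_div_zpow_add_two] at ihs
    have hcover : ∀ P ∈ tree Ps i ⟨k, n, 0⟩ ξ, P.k ≠ k →
        ∃ q ∈ Finset.range 4, P ∈ tree Ps i ⟨k + 2, 4 * n + (q : ℕ), 0⟩ ξ := by
      intro P hP hne
      obtain ⟨h1, h2, h3⟩ := mem_tree.1 hP
      obtain ⟨q, hq, h4⟩ := exists_quarter ((hpar P h1).trans hk.symm) hne h2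
      exact ⟨q, hq, mem_tree.2 ⟨h1, h4, h3⟩⟩
    have h2k : (2 : ℝ) ^ (-k) = 4 * 2 ^ (-(k + 2)) := by
      rw [show -k = 2 + -(k + 2) by ring, zpow_add₀ two_ne_zero]; norm_num
    set l := ⌊ξ / (2 : ℝ) ^ k⌋₊ with hl
    -- If `I(k,n)` belongs to a member of the tree, the density bound there makes all four quarters
    -- small enough for `huber` to be a square; Parseval then pays for the `j`-th coefficient and
    -- still leaves the `i`-th, which lies over `ξ`. Otherwise no coefficient is added at this scale
    -- and convexity suffices.
    by_cases htop : ∃ P₁ ∈ tree Ps i ⟨k, n, 0⟩ ξ, P₁.k = k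
    · obtain ⟨P₁, hP₁, hk₁⟩ := htop
      obtain ⟨hPs₁, hI₁, hξ₁⟩ := mem_tree.1 hP₁
      have hn : ∀ P ∈ tree Ps i ⟨k, n, 0⟩ ξ, P.k = k → P.n = n := by
        intro P hP hkP
        have hI := (mem_tree.1 hP).2.1
        have h1 := left_mem_dyadic (-P.k) P.n
        have h2 := hI h1
        rw [Quartile.I] at h2
        simp only [hkP] at h1 h2
        exact eq_of_mem_dyadic h1 h2
      have hlP : ∀ P ∈ tree Ps i ⟨k, n, 0⟩ ξ, P.k = k → 4 * P.l + i = l := by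
        intro P hP hkP
        have h1 := (mem_tree.1 hP).2.2
        rw [Tile.ω, Quartile.sub, hkP] at h1
        exact (floor_of_mem_dyadic h1).symm
      have hn₁ := hn P₁ hP₁ hk₁
      have hl₁ := hlP P₁ hP₁ hk₁
      have hl4 : l / 4 = P₁.l := by have := i.2; omega
      rw [← Finset.add_sum_erase _ _ hP₁]
      have hsum : ∑ P ∈ (tree Ps i ⟨k, n, 0⟩ ξ).erase P₁, ‖coeff F P.k P.n (4 * P.l + j)‖ ^ 2 ≤ _ :=
        sum_le_sum_sum_of_cover (Finset.range 4)
          (fun q => tree Ps i ⟨k + 2, 4 * n + (q : ℕ), 0⟩ ξ) (fun P hP => by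
          obtain ⟨hne, hP⟩ := Finset.mem_erase.1 hP
          refine hcover P hP fun hkP => hne ?_
          have h1 := hlP P hP hkP
          ext
          · rw [hkP, hk₁]
          · rw [hn P hP hkP, hn₁]
          · omega) (fun _ => sq_nonneg _)
      have hpar4 := norm_coeff_sq_add_le F k n P₁.l hij
      rw [hl₁] at hpar4
      have hMtop := hPd P₁ hPs₁
      rw [hk₁, hn₁] at hMtop
      have hhub : ∀ q ∈ Finset.range 4, (2 : ℝ) ^ (-(k + 2)) * huber (4 * d)
          ((2 : ℝ) ^ (((k + 2 : ℤ) : ℝ) / 2) * ‖coeff F (k + 2) (4 * n + (q : ℕ)) (l / 4)‖) =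
          ‖coeff F (k + 2) (4 * n + (q : ℕ)) P₁.l‖ ^ 2 := by
        intro q hq
        -- The average of `|f|` over a quarter is at most four times that over the interval: this is
        -- the reason for the breakpoint `4d`.
        rw [huber_of_le, ← hsq, hl4]
        refine (hu _ _ _).trans ?_
        have h5 : M (k + 2) (4 * n + (q : ℕ)) ≤ d * (2 : ℝ) ^ (-k) :=
          (Finset.single_le_sum (f := fun q : ℕ => M (k + 2) (4 * n + (q : ℕ)))
            (fun _ _ => hM0 _ _) hq).trans (by rw [← hM4]; exact hMtop)
        refine (mul_le_mul_of_nonneg_left h5 (by positivity)).trans_eq ?_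
        rw [h2k]
        linear_combination (4 * d) * hpow (k + 2)
      rw [Finset.mul_sum, Finset.sum_congr rfl hhub] at ihs
      have hself := mul_le_mul_of_nonneg_left (huber_le_sq (4 * d)
        ((2 : ℝ) ^ ((k : ℝ) / 2) * ‖coeff F k n l‖)) (by positivity : (0 : ℝ) ≤ 2 ^ (-k))
      rw [← hsq] at hself
      rw [hk₁, hn₁]
      linarith
    · push Not at htop
      have hsum : ∑ P ∈ tree Ps i ⟨k, n, 0⟩ ξ, ‖coeff F P.k P.n (4 * P.l + j)‖ ^ 2 ≤ _ :=
        sum_le_sum_sum_of_cover (Finset.range 4)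
          (fun q => tree Ps i ⟨k + 2, 4 * n + (q : ℕ), 0⟩ ξ)
          (fun P hP => hcover P hP (htop P hP)) (fun _ => sq_nonneg _)
      have havg := huber_le_average (c := 4 * d) (t := (2 : ℝ) ^ ((k : ℝ) / 2) * ‖coeff F k n l‖)
        (by positivity) (by positivity)
        (fun q => (2 : ℝ) ^ (((k + 2 : ℤ) : ℝ) / 2) * ‖coeff F (k + 2) (4 * n + (q : ℕ)) (l / 4)‖)
        (by
          rw [← Finset.mul_sum, half_rpow_add_two]
          refine (mul_le_mul_of_nonneg_left (norm_coeff_four_le F k n l)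
            (by positivity)).trans_eq ?_
          ring)
      have h6 := mul_le_mul_of_nonneg_left havg (by positivity : (0 : ℝ) ≤ 2 ^ (-k))
      rw [h2k] at h6 ⊢
      linarith

/-- The size estimate for the coefficients of `f`. -/
theorem sum_tree_coeff_le (F : Lp ℂ 2 (volume : Measure ℝ)) {M : ℤ → ℤ → ℝ}
    (hM : ∀ (k n : ℤ) (l : ℕ), ‖coeff F k n l‖ ≤ (2 : ℝ) ^ ((k : ℝ) / 2) * M k n)
    (hM4 : ∀ k n, M k n = ∑ q ∈ Finset.range 4, M (k + 2) (4 * n + (q : ℕ)))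
    (hM0 : ∀ k n, 0 ≤ M k n)
    {Ps : Finset Quartile} {r : ℤ} (hpar : ∀ P ∈ Ps, P.k % 2 = r) {d : ℝ} (hd : 0 ≤ d)
    (hPd : ∀ P ∈ Ps, M P.k P.n ≤ d * (2 : ℝ) ^ (-P.k)) {i j : Fin 3} (hij : i ≠ j) (ξ : ℝ)
    {P₀ : Quartile} (hP₀ : P₀ ∈ Ps) :
    ∑ P ∈ tree Ps i P₀ ξ, ‖coeff F P.k P.n (4 * P.l + j)‖ ^ 2 ≤
      8 * d ^ 2 * volume.real P₀.I := by
  obtain ⟨K, hK⟩ : ∃ K : ℤ, ∀ P ∈ Ps, P.k < K := by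
    obtain ⟨K, hK⟩ := (Ps.image Quartile.k).bddAbove
    exact ⟨K + 1, fun P hP => Int.lt_add_one_iff.2 (hK (by
      rw [Finset.coe_image]; exact ⟨P, hP, rfl⟩))⟩
  have h := sum_tree_coeff_add_huber_le F hM hM4 hM0 hpar hd hPd hij ξ hK (K - P₀.k).toNat
    P₀.k P₀.n (hpar P₀ hP₀) (by omega)
  have hnn : 0 ≤ huber (4 * d) ((2 : ℝ) ^ ((P₀.k : ℝ) / 2) *
      ‖coeff F P₀.k P₀.n ⌊ξ / (2 : ℝ) ^ P₀.k⌋₊‖) := by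
    have := affine_le_huber (c := 4 * d) (t := (2 : ℝ) ^ ((P₀.k : ℝ) / 2) *
      ‖coeff F P₀.k P₀.n ⌊ξ / (2 : ℝ) ^ P₀.k⌋₊‖) (s := 0) (by positivity)
    simpa using this
  have h2 := mul_nonneg (by positivity : (0 : ℝ) ≤ 2 ^ (-P₀.k)) hnn
  have h3 := mul_le_mul_of_nonneg_left (hPd P₀ hP₀) (by positivity : 0 ≤ 8 * d)
  rw [P₀.volume_real_I]
  -- Only the time interval of the top enters a tree, so its frequency index may be set to 0.
  have h4 : tree Ps i P₀ ξ = tree Ps i ⟨P₀.k, P₀.n, 0⟩ ξ := rfl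
  rw [h4]
  linarith

/-! ### Energy and size of the coefficients of functions in `X E`. -/

section Bounded

variable {E : Set ℝ} {f : ℝ → ℂ}

theorem norm_le_indicator_of_mem_X (hf : f ∈ X E) :
    ∀ᵐ x, ‖f x‖ ≤ ‖E.indicator (fun _ => (1 : ℝ)) x‖ := by
  obtain ⟨-, h0, h1⟩ := hf
  rw [eLpNorm_exponent_top] at h1
  filter_upwards [h0, ae_le_eLpNormEssSup (f := f) (μ := volume)] with x hx hx1
  by_cases hxE : x ∈ E
  · rw [Set.indicator_of_mem hxE, norm_one]
    have := hx1.trans h1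
    rw [← ofReal_norm, ENNReal.ofReal_le_one] at this
    exact this
  · rw [hx hxE, norm_zero]; positivity

theorem eLpNorm_le_of_mem_X (hE : NullMeasurableSet E volume) (hf : f ∈ X E) {p : ENNReal}
    (hp0 : p ≠ 0) (hp : p ≠ ⊤) : eLpNorm f p volume ≤ volume E ^ (1 / p.toReal) := by
  refine (eLpNorm_mono_ae (norm_le_indicator_of_mem_X hf)).trans_eq ?_
  rw [eLpNorm_indicator_const₀ hE hp0 hp]
  simp

theorem memLp_of_mem_X (hE : NullMeasurableSet E volume) (hE' : volume E < ⊤) (hf : f ∈ X E)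
    {p : ENNReal} (hp0 : p ≠ 0) (hp : p ≠ ⊤) : MemLp f p volume :=
  ⟨hf.1, (eLpNorm_le_of_mem_X hE hf hp0 hp).trans_lt
    (ENNReal.rpow_lt_top_of_nonneg (by positivity) hE'.ne)⟩

theorem norm_toLp_le_of_mem_X (hE : NullMeasurableSet E volume) (hE' : volume E < ⊤) (hf : f ∈ X E)
    (hf2 : MemLp f 2 volume) : ‖hf2.toLp f‖ ≤ volume.real E ^ (1 / 2 : ℝ) := by
  rw [Lp.norm_toLp, measureReal_def, ENNReal.toReal_rpow]
  refine ENNReal.toReal_mono (ENNReal.rpow_ne_top_of_nonneg (by norm_num) hE'.ne) ?_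
  simpa using eLpNorm_le_of_mem_X hE hf (p := 2) (by norm_num) (by norm_num)

theorem setIntegral_norm_le_of_mem_X (hE : NullMeasurableSet E volume) (hE' : volume E < ⊤)
    (hf : f ∈ X E) (m a : ℤ) :
    ∫ x in dyadic m a, ‖f x‖ ≤ volume.real (E ∩ dyadic m a) := by
  have hint : Integrable f volume := memLp_one_iff_integrable.1
    (memLp_of_mem_X hE hE' hf (by norm_num) (by norm_num))
  have hEr : NullMeasurableSet E (volume.restrict (dyadic m a)) :=
    hE.mono_ac Measure.absolutelyContinuous_restrict
  calc ∫ x in dyadic m a, ‖f x‖ ≤ ∫ x in dyadic m a, E.indicator (fun _ => (1 : ℝ)) x := by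
        apply integral_mono_ae hint.norm.integrableOn
        · exact (IntegrableOn.integrable_indicator₀
            (integrableOn_const ((Measure.restrict_apply_le _ _).trans_lt hE').ne) hEr)
        · filter_upwards [ae_restrict_of_ae (norm_le_indicator_of_mem_X hf)] with x hx
          refine hx.trans_eq (Real.norm_of_nonneg ?_)
          exact Set.indicator_nonneg (fun _ _ => zero_le_one) _
    _ = volume.real (E ∩ dyadic m a) := by
        rw [integral_indicator₀ hEr, setIntegral_const, smul_eq_mul, mul_one, measureReal_def,
          Measure.restrict_apply' (measurableSet_dyadic m a), ← measureReal_def]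

end Bounded

theorem norm_pairing_φ_le (f : ℝ → ℂ) (s : Tile) :
    ‖pairing f s.φ‖ ≤ (2 : ℝ) ^ ((s.k : ℝ) / 2) * ∫ x in s.I, ‖f x‖ := by
  classical
  refine (norm_integral_le_integral_norm _).trans_eq ?_
  rw [← integral_const_mul, ← integral_indicator (show MeasurableSet s.I from
    measurableSet_dyadic _ _)]
  congr 1
  funext x
  rw [norm_mul, RCLike.norm_conj, s.norm_φ]
  by_cases hx : x ∈ s.I
  · simp [hx, mul_comm]
  · simp [hx]

theorem dyadic_eq_union (m a : ℤ) :
    dyadic (m + 1) a = dyadic m (2 * a) ∪ dyadic m (2 * a + 1) := by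
  have hp : (0 : ℝ) < 2 ^ m := by positivity
  unfold dyadic
  push_cast
  rw [Set.Ico_union_Ico_eq_Ico (by nlinarith) (by nlinarith), zpow_add_one₀ two_ne_zero]
  congr 1 <;> ring

theorem disjoint_dyadic {m a b : ℤ} (h : a ≠ b) : Disjoint (dyadic m a) (dyadic m b) :=
  Set.disjoint_left.2 fun _ hx hx' => h (eq_of_mem_dyadic hx hx')

theorem setIntegral_dyadic_halves {f : ℝ → ℝ} (hf : Integrable f volume) (m a : ℤ) :
    ∫ x in dyadic (m + 1) a, f x =
      (∫ x in dyadic m (2 * a), f x) + ∫ x in dyadic m (2 * a + 1), f x := by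
  rw [dyadic_eq_union, setIntegral_union (disjoint_dyadic (by omega)) (measurableSet_dyadic _ _)
    hf.integrableOn hf.integrableOn]

theorem setIntegral_dyadic_quarters {f : ℝ → ℝ} (hf : Integrable f volume) (k n : ℤ) :
    ∫ x in dyadic (-k) n, f x =
      ∑ q ∈ Finset.range 4, ∫ x in dyadic (-(k + 2)) (4 * n + (q : ℕ)), f x := by
  have e : -k = -(k + 2) + 1 + 1 := by ring
  have n0 : 2 * (2 * n) = 4 * n := by ring
  have n2 : 2 * (2 * n + 1) = 4 * n + 2 := by ring
  have n3 : 4 * n + 2 + 1 = 4 * n + 3 := by ring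
  rw [e, setIntegral_dyadic_halves hf, setIntegral_dyadic_halves hf, setIntegral_dyadic_halves hf,
    n0, n2, n3]
  simp [Finset.sum_range_succ]
  ring

theorem le_supDensity {Ps : Finset Quartile} (E : Set ℝ) {P : Quartile} (hP : P ∈ Ps) :
    volume.real (E ∩ P.I) ≤ supDensity Ps E * 2 ^ (-P.k) := by
  have h := le_ciSup (f := fun P : Ps => volume.real (E ∩ (P : Quartile).I) /
    volume.real (P : Quartile).I) (Set.finite_range _).bddAbove ⟨P, hP⟩
  rw [← P.volume_real_I]
  exact (div_le_iff₀ P.volume_real_I_pos).1 h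

theorem supDensity_nonneg (Ps : Finset Quartile) (E : Set ℝ) : 0 ≤ supDensity Ps E :=
  Real.iSup_nonneg fun _ => by positivity

theorem energy_pairing_le {E : Set ℝ} {f : ℝ → ℂ} (hE : NullMeasurableSet E volume)
    (hE' : volume E < ⊤) (hf : f ∈ X E) (j : Fin 3) {D : Finset Quartile}
    (hD : (D : Set Quartile).Pairwise fun P P' => Disjoint (P.sub j).rect (P'.sub j).rect) :
    ∑ P ∈ D, ‖pairing f (P.sub j).φ‖ ^ 2 ≤ (volume.real E ^ (1 / 2 : ℝ)) ^ 2 := by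
  have hf2 := memLp_of_mem_X hE hE' hf (p := 2) (by norm_num) (by norm_num)
  have h := sum_norm_inner_vec_le (fun P : Quartile => P.sub j) D hD (hf2.toLp f)
  simp only [inner_vec_toLp] at h
  exact h.trans (pow_le_pow_left₀ (norm_nonneg _) (norm_toLp_le_of_mem_X hE hE' hf hf2) 2)

theorem size_pairing_le {E : Set ℝ} {f : ℝ → ℂ} (hE : NullMeasurableSet E volume)
    (hE' : volume E < ⊤) (hf : f ∈ X E) {Ps R : Finset Quartile} (hR : R ⊆ Ps) {r : ℤ}
    (hpar : ∀ P ∈ R, P.k % 2 = r) {i j : Fin 3} (hij : i ≠ j) {P₀ : Quartile} (hP₀ : P₀ ∈ R)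
    (ξ : ℝ) :
    ∑ P ∈ tree R i P₀ ξ, ‖pairing f (P.sub j).φ‖ ^ 2 ≤
      8 * supDensity Ps E ^ 2 * volume.real P₀.I := by
  have hf2 := memLp_of_mem_X hE hE' hf (p := 2) (by norm_num) (by norm_num)
  have hf1 : Integrable f volume := memLp_one_iff_integrable.1
    (memLp_of_mem_X hE hE' hf (by norm_num) (by norm_num))
  have h := sum_tree_coeff_le (hf2.toLp f) (M := fun k n => ∫ x in dyadic (-k) n, ‖f x‖)
    (fun k n l => by
      rw [coeff, inner_vec_toLp]; exact norm_pairing_φ_le f ⟨k, n, l⟩)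
    (fun k n => setIntegral_dyadic_quarters hf1.norm k n)
    (fun k n => integral_nonneg fun _ => norm_nonneg _) hpar (supDensity_nonneg Ps E)
    (fun P hP => (setIntegral_norm_le_of_mem_X hE hE' hf _ _).trans (le_supDensity E (hR hP)))
    hij ξ hP₀
  simp only [coeff, inner_vec_toLp] at h
  exact h

/-! ### Duality and reduction to the trilinear form. -/

open Classical in
/-- In the sum over the tiles `Q₃` with `ω_{Q₃} ⊆ ω_{P₁}` either no term or every term of the
unrestricted sum survives. -/
theorem norm_restricted_sum_le {D : Finset Quartile}
    (hD : (D : Set Quartile).Pairwise fun Q Q' => Disjoint (Q.sub 2).rect (Q'.sub 2).rect)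
    (b : Quartile → ℂ) (P : Quartile) :
    ‖∑ Q ∈ D with (Q.sub 2).ω ⊆ (P.sub 0).ω, b Q * pairing (P.sub 0).φ (Q.sub 2).φ‖ ≤
      ‖⟪(P.sub 0).vec, ∑ Q ∈ D, conj (b Q) • (Q.sub 2).vec⟫_ℂ‖ := by
  have hpair : ∀ Q : Quartile, pairing (P.sub 0).φ (Q.sub 2).φ =
      ⟪(Q.sub 2).vec, (P.sub 0).vec⟫_ℂ := fun Q => (inner_vec_toLp _ _).symm
  simp only [hpair]
  by_cases hex : ∃ Q ∈ D, (Q.sub 2).ω ⊆ (P.sub 0).ω ∧ ⟪(Q.sub 2).vec, (P.sub 0).vec⟫_ℂ ≠ 0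
  · obtain ⟨Q, hQ, hω, hne⟩ := hex
    obtain ⟨⟨x, hxQ, hxP⟩, -⟩ := not_disjoint_rect_iff.1 fun h => hne (inner_vec_of_disjoint h)
    have hkQ : Q.k ≤ P.k := le_of_dyadic_subset hω
    -- One surviving tile `Q₃` is at least as wide in time as `P₁`. A tile `Q'₃` that meets `P₁`
    -- without satisfying the restriction has a frequency interval containing `ω_{P₁}`, hence also
    -- `ω_{Q₃}`, and so meets `Q₃`, against disjointness.
    have hIPQ : (P.sub 0).I ⊆ (Q.sub 2).I :=
      dyadic_subset_of_mem (by simp only [Quartile.sub]; omega) hxP hxQ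
    rw [norm_inner_symm, sum_inner, Finset.sum_filter]
    refine le_of_eq (congrArg _ (Finset.sum_congr rfl fun Q' hQ' => ?_))
    rw [inner_smul_left, Complex.conj_conj]
    split_ifs with hω'
    · rfl
    · symm
      rw [mul_eq_zero]
      right
      by_contra hne'
      obtain ⟨⟨y, hyQ, hyP⟩, z, hzQ, hzP⟩ :=
        not_disjoint_rect_iff.1 fun h => hne' (inner_vec_of_disjoint h)
      have hk : P.k ≤ Q'.k := by
        by_contra hlt
        exact hω' (dyadic_subset_of_mem (by simp only [Quartile.sub]; omega) hzQ hzP)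
      have hω'' : (P.sub 0).ω ⊆ (Q'.sub 2).ω :=
        dyadic_subset_of_mem (by simp only [Quartile.sub]; omega) hzP hzQ
      have hmeet : ¬ Disjoint (Q.sub 2).rect (Q'.sub 2).rect :=
        not_disjoint_rect_iff.2 ⟨⟨y, hIPQ hyP, hyQ⟩, _, left_mem_dyadic _ _,
          hω'' (hω (left_mem_dyadic _ _))⟩
      have hQQ : Q = Q' := by
        by_contra h
        exact hmeet (hD hQ hQ' h)
      exact hω' (hQQ ▸ hω)
  · push Not at hex
    rw [Finset.sum_eq_zero]
    · rw [norm_zero]; positivity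
    · intro Q hQ
      obtain ⟨hQ, hω⟩ := Finset.mem_filter.1 hQ
      rw [hex Q hQ hω, mul_zero]

/-- The trilinear estimate for the coefficients of `f₃` and `f₄`. -/
theorem sum_triWeight_pairing_le {θ : ℝ} (hθ0 : 0 < θ) (hθ1 : θ < 1) {E₃ E₄ : Set ℝ}
    {f₃ f₄ : ℝ → ℂ} (hE₃ : NullMeasurableSet E₃ volume) (hE₄ : NullMeasurableSet E₄ volume)
    (hE₃' : volume E₃ < ⊤) (hE₄' : volume E₄ < ⊤) (hf₃ : f₃ ∈ X E₃) (hf₄ : f₄ ∈ X E₄)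
    (Ps : Finset Quartile) {a : Quartile → ℝ} (ha : ∀ P, 0 ≤ a P) {A : ℝ} (hA : 0 < A)
    (haA : ∀ D : Finset Quartile, (D : Set Quartile).Pairwise
      (fun P P' => Disjoint (P.sub 0).rect (P'.sub 0).rect) → ∑ P ∈ D, a P ^ 2 ≤ A ^ 2) :
    ∑ P ∈ Ps, triWeight ![a, fun P => ‖pairing f₃ (P.sub 1).φ‖, fun P => ‖pairing f₄ (P.sub 2).φ‖] P
      ≤ 1728 / (1 - (1 / 2) ^ min θ (1 - θ)) * A *
        ((volume.real E₄ ^ (1 / 2 : ℝ) * supDensity Ps E₃) ^ (1 - θ) *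
          (volume.real E₃ ^ (1 / 2 : ℝ) * supDensity Ps E₄) ^ θ) := by
  classical
  set w := triWeight ![a, fun P => ‖pairing f₃ (P.sub 1).φ‖, fun P => ‖pairing f₄ (P.sub 2).φ‖]
  have hd₃ := supDensity_nonneg Ps E₃
  have hd₄ := supDensity_nonneg Ps E₄
  have hv₃ : 0 ≤ volume.real E₃ ^ (1 / 2 : ℝ) := by positivity
  have hv₄ : 0 ≤ volume.real E₄ ^ (1 / 2 : ℝ) := by positivity
  -- Adding `ε` makes all energies and sizes strictly positive; it is sent to 0 at the end.
  have key : ∀ ε : ℝ, 0 < ε → ∀ r : ℤ, ∑ P ∈ Ps with P.k % 2 = r, w P ≤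
      288 / (1 - (1 / 2) ^ min θ (1 - θ)) * A *
        (((volume.real E₄ ^ (1 / 2 : ℝ) + ε) * (3 * (supDensity Ps E₃ + ε))) ^ (1 - θ) *
          ((volume.real E₃ ^ (1 / 2 : ℝ) + ε) * (3 * (supDensity Ps E₄ + ε))) ^ θ) := by
    intro ε hε r
    have hpar : ∀ P ∈ Ps.filter (fun P => P.k % 2 = r), P.k % 2 = r := fun P hP =>
      (Finset.mem_filter.1 hP).2
    have hsize : ∀ {E : Set ℝ} {f : ℝ → ℂ}, NullMeasurableSet E volume → volume E < ⊤ → f ∈ X E →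
        ∀ i j : Fin 3, i ≠ j → ∀ P₀ ∈ Ps.filter (fun P => P.k % 2 = r), ∀ ξ : ℝ,
        ∑ P ∈ tree (Ps.filter (fun P => P.k % 2 = r)) i P₀ ξ, ‖pairing f (P.sub j).φ‖ ^ 2 ≤
          (3 * (supDensity Ps E + ε)) ^ 2 * volume.real P₀.I := by
      intro E f hE hE' hf i j hij P₀ hP₀ ξ
      refine (size_pairing_le hE hE' hf (Finset.filter_subset _ _) hpar hij hP₀ ξ).trans ?_
      have := supDensity_nonneg Ps E
      refine mul_le_mul_of_nonneg_right ?_ P₀.volume_real_I_pos.le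
      -- The factor 3 stands for `√8` in the size bound.
      nlinarith
    refine sum_triWeight_le hθ0 hθ1 hpar
      (E := ![A, volume.real E₃ ^ (1 / 2 : ℝ) + ε, volume.real E₄ ^ (1 / 2 : ℝ) + ε]) ?_ ?_ ?_
      (by positivity) (by positivity)
      (fun i hi => hsize hE₃ hE₃' hf₃ i 1 hi) (fun i hi => hsize hE₄ hE₄' hf₄ i 2 hi)
    · intro j P
      obtain rfl | rfl | rfl : j = 0 ∨ j = 1 ∨ j = 2 := by omega
      · exact ha P
      · exact norm_nonneg _
      · exact norm_nonneg _
    · intro j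
      obtain rfl | rfl | rfl : j = 0 ∨ j = 1 ∨ j = 2 := by omega
      · exact hA
      · exact add_pos_of_nonneg_of_pos hv₃ hε
      · exact add_pos_of_nonneg_of_pos hv₄ hε
    · intro j D _ hD
      obtain rfl | rfl | rfl : j = 0 ∨ j = 1 ∨ j = 2 := by omega
      · exact haA D hD
      · exact (energy_pairing_le hE₃ hE₃' hf₃ 1 hD).trans
          (pow_le_pow_left₀ hv₃ (le_add_of_nonneg_right hε.le) 2)
      · exact (energy_pairing_le hE₄ hE₄' hf₄ 2 hD).trans
          (pow_le_pow_left₀ hv₄ (le_add_of_nonneg_right hε.le) 2)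
  have hsplit : ∑ P ∈ Ps, w P = ∑ P ∈ Ps with P.k % 2 = 0, w P + ∑ P ∈ Ps with P.k % 2 = 1, w P := by
    rw [← Finset.sum_filter_add_sum_filter_not Ps (fun P => P.k % 2 = 0)]
    congr 2
    ext P
    simp only [Finset.mem_filter, Int.emod_two_ne_zero]
  -- The two parity classes double 288 to 576; the factor 3 in the sizes later gives 1728.
  have key2 : ∀ ε : ℝ, 0 < ε → ∑ P ∈ Ps, w P ≤
      576 / (1 - (1 / 2) ^ min θ (1 - θ)) * A *
        (((volume.real E₄ ^ (1 / 2 : ℝ) + ε) * (3 * (supDensity Ps E₃ + ε))) ^ (1 - θ) *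
          ((volume.real E₃ ^ (1 / 2 : ℝ) + ε) * (3 * (supDensity Ps E₄ + ε))) ^ θ) := by
    intro ε hε
    rw [hsplit]
    refine (add_le_add (key ε hε 0) (key ε hε 1)).trans_eq ?_
    ring
  have hcont : Continuous fun ε : ℝ => 576 / (1 - (1 / 2) ^ min θ (1 - θ)) * A *
        (((volume.real E₄ ^ (1 / 2 : ℝ) + ε) * (3 * (supDensity Ps E₃ + ε))) ^ (1 - θ) *
          ((volume.real E₃ ^ (1 / 2 : ℝ) + ε) * (3 * (supDensity Ps E₄ + ε))) ^ θ) := by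
    refine continuous_const.mul (Continuous.mul ?_ ?_)
    · exact Continuous.rpow_const (by fun_prop) fun _ => Or.inr (by linarith)
    · exact Continuous.rpow_const (by fun_prop) fun _ => Or.inr hθ0.le
  have hlim := ge_of_tendsto ((hcont.tendsto 0).mono_left nhdsWithin_le_nhds)
    (show ∀ᶠ ε in nhdsWithin (0 : ℝ) (Set.Ioi 0), _ by
      filter_upwards [self_mem_nhdsWithin] with ε hε using key2 ε hε)
  refine hlim.trans_eq ?_
  simp only [add_zero]
  have h3 : (3 : ℝ) ^ (1 - θ) * 3 ^ θ = 3 := by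
    rw [← Real.rpow_add (by norm_num)]; simp
  rw [mul_left_comm (volume.real E₄ ^ (1 / 2 : ℝ)), mul_left_comm (volume.real E₃ ^ (1 / 2 : ℝ)),
    Real.mul_rpow (x := 3) (by norm_num) (mul_nonneg hv₄ hd₃),
    Real.mul_rpow (x := 3) (by norm_num) (mul_nonneg hv₃ hd₄)]
  linear_combination (576 / (1 - (1 / 2) ^ min θ (1 - θ)) * A *
        ((volume.real E₄ ^ (1 / 2 : ℝ) * supDensity Ps E₃) ^ (1 - θ) *
          (volume.real E₃ ^ (1 / 2 : ℝ) * supDensity Ps E₄) ^ θ)) * h3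

/-- Pairing the sequence `a3` with `b`, and summing over the tiles of `D` first. -/
theorem norm_sum_mul_a3_le (Ps D : Finset Quartile) (f₃ f₄ : ℝ → ℂ) (b : Quartile → ℂ)
    (hD : (D : Set Quartile).Pairwise fun Q Q' => Disjoint (Q.sub 2).rect (Q'.sub 2).rect) :
    ‖∑ Q ∈ D, b Q * a3 Ps f₃ f₄ Q‖ ≤
      ∑ P ∈ Ps, triWeight ![fun P => ‖⟪(P.sub 0).vec, ∑ Q ∈ D, conj (b Q) • (Q.sub 2).vec⟫_ℂ‖,
        fun P => ‖pairing f₃ (P.sub 1).φ‖, fun P => ‖pairing f₄ (P.sub 2).φ‖] P := by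
  classical
  have hswap : ∑ Q ∈ D, b Q * a3 Ps f₃ f₄ Q = ∑ P ∈ Ps,
      ((1 / (volume.real P.I) ^ (1 / 2 : ℝ) : ℝ) : ℂ) * pairing f₃ (P.sub 1).φ *
        pairing f₄ (P.sub 2).φ * ∑ Q ∈ D with (Q.sub 2).ω ⊆ (P.sub 0).ω,
          b Q * pairing (P.sub 0).φ (Q.sub 2).φ := by
    simp only [a3, Finset.mul_sum, Finset.sum_filter, mul_ite, mul_zero]
    rw [Finset.sum_comm]
    refine Finset.sum_congr rfl fun P _ => Finset.sum_congr rfl fun Q _ => ?_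
    split_ifs
    · ring
    · rfl
  rw [hswap]
  refine (norm_sum_le _ _).trans (Finset.sum_le_sum fun P _ => ?_)
  have hv : 0 ≤ 1 / (volume.real P.I) ^ (1 / 2 : ℝ) := by positivity
  rw [norm_mul, norm_mul, norm_mul, Complex.norm_real, Real.norm_of_nonneg hv]
  have h := norm_restricted_sum_le hD b P
  simp only [triWeight, Matrix.cons_val]
  calc _ ≤ 1 / (volume.real P.I) ^ (1 / 2 : ℝ) * ‖pairing f₃ (P.sub 1).φ‖ *
        ‖pairing f₄ (P.sub 2).φ‖ *
          ‖⟪(P.sub 0).vec, ∑ Q ∈ D, conj (b Q) • (Q.sub 2).vec⟫_ℂ‖ := by gcongr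
    _ = _ := by ring

end WalshBiest

end

/-! ### Conclusion. -/

open WalshBiest in
theorem lemma6p3 (θ : ℝ) (hθ0 : 0 < θ) (hθ1 : θ < 1) :
    ∃ C : ℝ, 0 < C ∧
      ∀ (Ps Qs : Finset WalshBiest.Quartile) (E₃ E₄ : Set ℝ),
        NullMeasurableSet E₃ volume → NullMeasurableSet E₄ volume →
        volume E₃ < ⊤ → volume E₄ < ⊤ →
        ∀ f₃ ∈ WalshBiest.X E₃, ∀ f₄ ∈ WalshBiest.X E₄,
          WalshBiest.energy 2 Qs (WalshBiest.a3 Ps f₃ f₄) ≤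
            C * ((volume.real E₄) ^ (1 / 2 : ℝ) * WalshBiest.supDensity Ps E₃) ^ (1 - θ) *
              ((volume.real E₃) ^ (1 / 2 : ℝ) * WalshBiest.supDensity Ps E₄) ^ θ := by
  have hδ0 : 0 < min θ (1 - θ) := lt_min hθ0 (by linarith)
  have hq1 : ((1 : ℝ) / 2) ^ min θ (1 - θ) < 1 := Real.rpow_lt_one (by norm_num) (by norm_num) hδ0
  have hq2 : 0 < 1 - ((1 : ℝ) / 2) ^ min θ (1 - θ) := by linarith
  refine ⟨1728 / (1 - (1 / 2) ^ min θ (1 - θ)), by positivity, ?_⟩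
  intro Ps Qs E₃ E₄ hE₃ hE₄ hE₃' hE₄' f₃ hf₃ f₄ hf₄
  have hd₃ := supDensity_nonneg Ps E₃
  have hd₄ := supDensity_nonneg Ps E₄
  refine Real.sSup_le ?_ (by positivity)
  rintro _ ⟨D, -, hD, rfl⟩
  rw [← Real.sqrt_eq_rpow]
  set A := √(∑ Q ∈ D, ‖a3 Ps f₃ f₄ Q‖ ^ 2) with hA
  have hA0 : 0 ≤ A := Real.sqrt_nonneg _
  have hA2 : A ^ 2 = ∑ Q ∈ D, ‖a3 Ps f₃ f₄ Q‖ ^ 2 :=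
    Real.sq_sqrt (Finset.sum_nonneg fun _ _ => sq_nonneg _)
  -- The argument yields `A² ≤ C·A·(…)`, so the case `A = 0` is set aside before dividing.
  rcases hA0.eq_or_lt with hA0 | hA0
  · rw [← hA0]; positivity
  set b : Quartile → ℂ := fun Q => (starRingEnd ℂ) (a3 Ps f₃ f₄ Q) with hb
  have hnorm : ‖∑ Q ∈ D, (starRingEnd ℂ) (b Q) • (Q.sub 2).vec‖ ^ 2 = A ^ 2 := by
    rw [norm_sum_vec_sq (fun Q : Quartile => Q.sub 2) D hD, hA2]
    simp [hb]
  have hdual : ‖∑ Q ∈ D, b Q * a3 Ps f₃ f₄ Q‖ = A ^ 2 := by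
    have : ∀ Q, b Q * a3 Ps f₃ f₄ Q = ((‖a3 Ps f₃ f₄ Q‖ ^ 2 : ℝ) : ℂ) := fun Q => by
      rw [hb, Complex.conj_mul']; push_cast; rfl
    simp only [this]
    rw [← Complex.ofReal_sum, ← hA2, Complex.norm_real, Real.norm_of_nonneg (sq_nonneg _)]
  have h1 := norm_sum_mul_a3_le Ps D f₃ f₄ b hD
  have h2 := sum_triWeight_pairing_le hθ0 hθ1 hE₃ hE₄ hE₃' hE₄' hf₃ hf₄ Ps
    (a := fun P => ‖inner ℂ (P.sub 0).vec (∑ Q ∈ D, (starRingEnd ℂ) (b Q) • (Q.sub 2).vec)‖)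
    (fun _ => norm_nonneg _) hA0 (fun D' hD' => by
      rw [← hnorm]
      exact sum_norm_inner_vec_le (fun P : Quartile => P.sub 0) D' hD' _)
  rw [hdual] at h1
  refine le_of_mul_le_mul_right ?_ hA0
  rw [← sq]
  refine (h1.trans h2).trans_eq ?_
  ring
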